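/- Let $H^2$ be the Hardy space of the open unit disc $\mathbb D$ (the functions $f(z)=\sum_{n\ge 0}a_nz^n$ with $\|f\|^2=\sum_n|a_n|^2<\infty$), let $S\colon H^2\to H^2$, $(Sf)(z)=zf(z)$, be the unilateral shift of multiplicity one, and for $\lambda\in\mathbb D$ let $h_\lambda(z)=\frac{1}{1-\overline\lambda z}$, an element of $H^2$. All Hilbert spaces are complex and separable, and all operators are linear and bounded. An operator $T$ is power bounded if $\sup_{n\ge 1}\|T^n\|<\infty$, and polynomially bounded if there is a constant $C>0$ with $\|p(T)\|\le C\max_{|z|\le 1}|p(z)|$ for every complex polynomial $p$. A quasiaffinity is an injective bounded linear map with dense range. By $\dim$ we denote the Hilbert space dimension (the cardinality of an orthonormal basis), so that $\infty$ stands for $\aleph_0$. (1) $\|h_\lambda\|=(1-|\lambda|^2)^{-1/2}$ for every $\lambda\in\mathbb D$. (2) For every cardinal number $1\le N\le\infty$ there exist a Hilbert space $\mathcal H$, a power bounded operator $T$ on $\mathcal H$ and a quasiaffinity $X\colon\mathcal H\to H^2$ such that $XT=SX$, $\dim\ker T^*=N$, and $\|X^*h_\lambda\|\asymp\|h_\lambda\|=(1-|\lambda|^2)^{-1/2}$,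 that is, there are constants $c,C>0$ such that $c\,\|h_\lambda\|\le\|X^*h_\lambda\|\le C\,\|h_\lambda\|$ for all $\lambda\in\mathbb D$. (3) This is impossible for polynomially bounded operators when $N\ne 1$: if $T$ is a polynomially bounded operator on a Hilbert space $\mathcal H$ and there is a quasiaffinity $X\colon\mathcal H\to H^2$ with $XT=SX$, then $\dim\ker T^*=1$. -/

import Mathlib

open scoped ComplexConjugate Complex.UnitDisc

noncomputable section

/-! ### The Hardy space of the unit disc and the unilateral shift -/

/-- The Hilbert space `ℓ²` of square summable complex sequences. -/
abbrev SeqL2 : Type := lp (fun _ : ℕ => ℂ) 2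

/-- The functions on the unit disc that are sums of a power series with square summable
Taylor coefficients. -/
def hardySubmodule : Submodule ℂ (𝔻 → ℂ) where
  carrier := {f | ∃ a : SeqL2, ∀ z : 𝔻, HasSum (fun n : ℕ => a n * (z : ℂ) ^ n) (f z)}
  zero_mem' := ⟨0, fun z => by simp [hasSum_zero]⟩
  add_mem' := by
    rintro f g ⟨a, ha⟩ ⟨b, hb⟩
    exact ⟨a + b, fun z => by simpa [add_mul] using (ha z).add (hb z)⟩
  smul_mem' := by
    rintro c f ⟨a, ha⟩
    exact ⟨c • a, fun z => by simpa [mul_assoc] using (ha z).mul_left c⟩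

/-- The Hardy space `H²` of the unit disc, as a space of functions on the disc. It is a type of
its own because its topology is given by the `H²` norm, and not by pointwise convergence. -/
def HardyH2 : Type := hardySubmodule

namespace HardyH2

instance : AddCommGroup HardyH2 := inferInstanceAs (AddCommGroup hardySubmodule)
instance : Module ℂ HardyH2 := inferInstanceAs (Module ℂ hardySubmodule)
instance : FunLike HardyH2 𝔻 ℂ where
  coe f := f.1
  coe_injective := Subtype.val_injective

theorem ext {f g : HardyH2} (h : ∀ z : 𝔻, f z = g z) : f = g := DFunLike.ext f g h

@[simp] theorem add_apply (f g : HardyH2) (z : 𝔻) : (f + g) z = f z + g z := rfl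
@[simp] theorem smul_apply (c : ℂ) (f : HardyH2) (z : 𝔻) : (c • f) z = c * f z := rfl

theorem memℓp_geometric (z : 𝔻) : Memℓp (fun n : ℕ => conj (z : ℂ) ^ n) 2 := by
  refine memℓp_gen ?_
  have h : Summable fun n : ℕ => (‖(z : ℂ)‖ ^ 2) ^ n :=
    summable_geometric_of_lt_one (by positivity) z.sq_norm_lt_one
  refine h.congr fun n => ?_
  simp [← pow_mul, mul_comm]

theorem summable_coeff (a : SeqL2) (z : 𝔻) : Summable fun n : ℕ => a n * (z : ℂ) ^ n := by
  let b : SeqL2 := ⟨fun n : ℕ => conj (z : ℂ) ^ n, memℓp_geometric z⟩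
  have h := lp.summable_inner (𝕜 := ℂ) b a
  refine h.congr fun n => ?_
  simp [b, RCLike.inner_apply]

/-- The function `z ↦ ∑ aₙ zⁿ` in `H²`. -/
def ofCoeff : SeqL2 →ₗ[ℂ] HardyH2 where
  toFun a := ⟨fun z => ∑' n : ℕ, a n * (z : ℂ) ^ n, a, fun z => (summable_coeff a z).hasSum⟩
  map_add' a b := by
    refine ext fun z => ?_
    change ∑' n : ℕ, (a + b) n * (z : ℂ) ^ n = ∑' n : ℕ, a n * (z : ℂ) ^ n + ∑' n : ℕ, b n * (z : ℂ) ^ n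
    rw [← (summable_coeff a z).tsum_add (summable_coeff b z)]
    simp [add_mul]
  map_smul' c a := by
    refine ext fun z => ?_
    change ∑' n : ℕ, (c • a) n * (z : ℂ) ^ n = c * ∑' n : ℕ, a n * (z : ℂ) ^ n
    rw [← tsum_mul_left]
    simp [mul_assoc]

theorem ofCoeff_apply (a : SeqL2) (z : 𝔻) : ofCoeff a z = ∑' n : ℕ, a n * (z : ℂ) ^ n := rfl

theorem ofCoeff_eq {a : SeqL2} {f : HardyH2}
    (h : ∀ z : 𝔻, HasSum (fun n : ℕ => a n * (z : ℂ) ^ n) (f z)) : ofCoeff a = f :=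
  ext fun z => (h z).tsum_eq

theorem ofCoeff_injective : Function.Injective ofCoeff := by
  rw [← LinearMap.ker_eq_bot, LinearMap.ker_eq_bot']
  intro a ha
  have h0 : ∀ z : 𝔻, HasSum (fun n : ℕ => a n * (z : ℂ) ^ n) 0 := fun z => by
    have h := (summable_coeff a z).hasSum
    rw [← ofCoeff_apply, ha] at h
    exact h
  have hp : HasFPowerSeriesOnBall (fun _ : ℂ => (0 : ℂ))
      (FormalMultilinearSeries.ofScalars ℂ (fun n => a n)) 0 1 := by
    refine ⟨?_, one_pos, ?_⟩
    · refine ENNReal.le_of_forall_nnreal_lt fun r hr => ?_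
      have hr1 : ‖((r : ℝ) : ℂ)‖ < 1 := by simpa using hr
      refine FormalMultilinearSeries.le_radius_of_summable_norm _ ?_
      refine (summable_coeff a (Complex.UnitDisc.mk _ hr1)).norm.congr fun n => ?_
      simp
    · intro y hy
      have hy1 : ‖y‖ < 1 := by simpa [enorm_eq_nnnorm, ← NNReal.coe_lt_coe] using hy
      refine (h0 (Complex.UnitDisc.mk y hy1)).congr_fun fun n => ?_
      simp [mul_comm]
  have h1 := hp.hasFPowerSeriesAt.eq_zero
  ext n
  have h2 := congrArg (fun p => FormalMultilinearSeries.coeff p n) h1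
  rw [FormalMultilinearSeries.coeff_ofScalars] at h2
  exact h2

theorem ofCoeff_surjective : Function.Surjective ofCoeff := by
  rintro ⟨f, a, ha⟩
  exact ⟨a, ofCoeff_eq ha⟩

/-- A function in `H²` is identified with the sequence of its Taylor coefficients. -/
def coeffEquiv : HardyH2 ≃ₗ[ℂ] SeqL2 :=
  (LinearEquiv.ofBijective ofCoeff ⟨ofCoeff_injective, ofCoeff_surjective⟩).symm

theorem hasSum_coeff (f : HardyH2) (z : 𝔻) :
    HasSum (fun n : ℕ => coeffEquiv f n * (z : ℂ) ^ n) (f z) := by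
  have h := (summable_coeff (coeffEquiv f) z).hasSum
  rwa [← ofCoeff_apply,
    show ofCoeff (coeffEquiv f) = f from coeffEquiv.symm_apply_apply f] at h

theorem coeffEquiv_eq {a : SeqL2} {f : HardyH2}
    (h : ∀ z : 𝔻, HasSum (fun n : ℕ => a n * (z : ℂ) ^ n) (f z)) : coeffEquiv f = a := by
  rw [← ofCoeff_eq h]
  exact coeffEquiv.apply_symm_apply a

/-- The norm of `H²` is `‖∑ aₙ zⁿ‖ = (∑ |aₙ|²)^{1/2}`. -/
instance : NormedAddCommGroup HardyH2 :=
  NormedAddCommGroup.induced HardyH2 SeqL2 coeffEquiv.toLinearMap coeffEquiv.injective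

/-- The inner product of `H²` is the one of the sequences of Taylor coefficients. -/
instance : InnerProductSpace ℂ HardyH2 where
  norm_smul_le c f := by
    change ‖coeffEquiv (c • f)‖ ≤ ‖c‖ * ‖coeffEquiv f‖
    rw [map_smul]; exact norm_smul_le _ _
  inner f g := inner ℂ (coeffEquiv f) (coeffEquiv g)
  norm_sq_eq_re_inner f := norm_sq_eq_re_inner (coeffEquiv f)
  conj_inner_symm f g := inner_conj_symm _ _
  add_left f g h := by
    change inner ℂ (coeffEquiv (f + g)) _ = _
    rw [map_add]; exact inner_add_left _ _ _
  smul_left f g c := by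
    change inner ℂ (coeffEquiv (c • f)) _ = _
    rw [map_smul]; exact inner_smul_left _ _ _

theorem norm_eq (f : HardyH2) : ‖f‖ = ‖coeffEquiv f‖ := rfl

/-- The unitary identification of `H²` with `ℓ²`. -/
def coeffIsometry : HardyH2 ≃ₗᵢ[ℂ] SeqL2 := ⟨coeffEquiv, fun _ => rfl⟩

instance : CompleteSpace HardyH2 :=
  (completeSpace_congr (e := coeffEquiv.toEquiv)
    coeffIsometry.isometry.isUniformEmbedding).2 inferInstance

/-- The sequence `(0, a₀, a₁, …)`. -/
def shiftSeq (a : SeqL2) : SeqL2 :=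
  ⟨fun n => Nat.casesOn n 0 fun k => a k, by
    refine memℓp_gen ?_
    rw [← summable_nat_add_iff 1]
    exact (memℓp_gen_iff (by norm_num)).1 a.2⟩

theorem norm_shiftSeq (a : SeqL2) : ‖shiftSeq a‖ = ‖a‖ := by
  have h2 : 0 < (2 : ENNReal).toReal := by norm_num
  have hs : Summable fun n => ‖shiftSeq a n‖ ^ (2 : ENNReal).toReal :=
    (memℓp_gen_iff h2).1 (shiftSeq a).2
  rw [lp.norm_eq_tsum_rpow h2, lp.norm_eq_tsum_rpow h2, hs.tsum_eq_zero_add]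
  simp [shiftSeq]

theorem hasSum_shiftSeq (f : HardyH2) (z : 𝔻) :
    HasSum (fun n : ℕ => shiftSeq (coeffEquiv f) n * (z : ℂ) ^ n) ((z : ℂ) * f z) := by
  rw [← hasSum_nat_add_iff' 1]
  have h := (hasSum_coeff f z).mul_left (z : ℂ)
  simp only [Finset.range_one, Finset.sum_singleton]
  have h0 : shiftSeq (coeffEquiv f) 0 = 0 := rfl
  rw [h0, zero_mul, sub_zero]
  refine h.congr_fun fun n => ?_
  change coeffEquiv f n * (z : ℂ) ^ (n + 1) = _
  ring

/-- Multiplication by the independent variable, as a linear map. -/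
def shiftLinear : HardyH2 →ₗ[ℂ] HardyH2 where
  toFun f := ⟨fun z => (z : ℂ) * f z, shiftSeq (coeffEquiv f), hasSum_shiftSeq f⟩
  map_add' f g := ext fun z => mul_add (z : ℂ) (f z) (g z)
  map_smul' c f := ext fun z => mul_left_comm (z : ℂ) c (f z)

/-- The unilateral shift `S` of multiplicity one: `(S f)(z) = z f(z)`. -/
def shift : HardyH2 →L[ℂ] HardyH2 :=
  shiftLinear.mkContinuous 1 fun f => by
    rw [one_mul, norm_eq, norm_eq, coeffEquiv_eq (f := shiftLinear f) (hasSum_shiftSeq f),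
      norm_shiftSeq]

theorem shift_apply (f : HardyH2) (z : 𝔻) : shift f z = (z : ℂ) * f z := rfl

theorem norm_shift_apply (f : HardyH2) : ‖shift f‖ = ‖f‖ := by
  rw [norm_eq, norm_eq, coeffEquiv_eq (f := shift f) (hasSum_shiftSeq f), norm_shiftSeq]

/-- The function `h_l(z) = 1 / (1 - conj l * z)` in `H²`. -/
def kernel (l : 𝔻) : HardyH2 :=
  ⟨fun z => 1 / (1 - conj (l : ℂ) * (z : ℂ)),
    ⟨fun n : ℕ => conj (l : ℂ) ^ n, memℓp_geometric l⟩, fun z => by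
      have h : ‖conj (l : ℂ) * (z : ℂ)‖ < 1 := by
        rw [norm_mul, RCLike.norm_conj]
        exact mul_lt_one_of_nonneg_of_lt_one_left (norm_nonneg _) l.norm_lt_one z.norm_lt_one.le
      simpa [mul_pow, one_div] using hasSum_geometric_of_norm_lt_one h⟩

theorem kernel_apply (l z : 𝔻) : kernel l z = 1 / (1 - conj (l : ℂ) * (z : ℂ)) := rfl

end HardyH2

/-! ### Operators on Hilbert spaces -/

/-- `T` is power bounded: the norms of the powers `T ^ n`, `n ≥ 1`, are bounded. -/
def IsPowerBounded {H : Type*} [NormedAddCommGroup H] [InnerProductSpace ℂ H]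
    (T : H →L[ℂ] H) : Prop :=
  ∃ C : ℝ, ∀ n : ℕ, 1 ≤ n → ‖T ^ n‖ ≤ C

/-- `T` is polynomially bounded: `‖p(T)‖ ≤ C max {|p(z)| : |z| ≤ 1}` for every polynomial `p`. -/
def IsPolynomiallyBounded {H : Type*} [NormedAddCommGroup H] [InnerProductSpace ℂ H]
    (T : H →L[ℂ] H) : Prop :=
  ∃ C : ℝ, 0 < C ∧ ∀ p : Polynomial ℂ,
    ‖Polynomial.aeval T p‖ ≤ C * sSup ((fun z : ℂ => ‖p.eval z‖) '' Metric.closedBall 0 1)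

/-- `X` is a quasiaffinity: it is injective with dense range. -/
def IsQuasiaffinity {H K : Type*} [NormedAddCommGroup H] [InnerProductSpace ℂ H]
    [NormedAddCommGroup K] [InnerProductSpace ℂ K] (X : H →L[ℂ] K) : Prop :=
  Function.Injective X ∧ DenseRange X

/-- The Hilbert space dimension of `E` is `N`: there is an orthonormal basis of `E`, in the sense
of Hilbert spaces, of cardinality `N`. -/
def HasHilbertDim (E : Type*) [NormedAddCommGroup E] [InnerProductSpace ℂ E]
    (N : Cardinal.{0}) : Prop :=
  ∃ ι : Type, Nonempty (HilbertBasis ι ℂ E) ∧ Cardinal.mk ι = N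

end

noncomputable section

open Filter Topology Metric

/-! The norm of `h_λ` follows from its reproducing property.

Uniqueness for polynomially bounded `T`. Weak limits of polynomials in `T` give, for each bounded
holomorphic `φ` and each `x`, a vector `y` with `X y = φ · X x`. If `T* u = 0`, then `⟨u, y⟩ = φ(0)
⟨u, x⟩`, because `φ - φ(0)` is divisible by `z` and so `y - φ(0) x` lies in the range of `T`.
Functions in `H²` are quotients of bounded ones with denominator nonzero at `0`
(`HardyH2.exists_bounded_quotient`). So if `X x` vanishes at `0` and `X g` does not, suitable
bounded multiples of `X x` and `X g` coincide, and comparing them gives `⟨u, x⟩ = 0`. Hence `u` is a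
multiple of `X* h_0`.

Construction for arbitrary `N`. Renorm a dense, shift-invariant set of power series so that it
carries extra continuous functionals that vanish on the range of the shift. Choose disjoint windows
`[3l, 4l]`, with `l` distinct powers of four, and for each branch `p` and each `q` use `4^q` of
them. For each `p` and `q`, coefficients at the same distance from the right ends of these windows
are added up; at the right ends themselves these sums must approach a limit, the branch coordinate
of `p`, and the errors must be square summable over all `p`, `q` and distances. A power of the shift
moves the sums along the windows and lets in new coefficients, each used at most once, whence the
bound `2` (`norm_powSucc_le`). It also sends all branch coordinates to `0`, so each branch adds a
dimension to `ker T*` besides the one from the constant `1`. The branch functionals are nonzero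
because the weight `1` spread evenly over `4^q` places has norm only `2^{-q}` (`branchVec_mem`).

The kernel estimate holds because outside the windows the norm is the old one, and the coefficients
of `h_λ` decrease in modulus, so those in windows are dominated by free ones
(`norm_le_two_mul_norm_freePart`). -/

/-- The vectors `(1 - z L)⁻¹ f` depend holomorphically on `z` in the disc if `L` is a contraction. -/
theorem exists_resolvent_apply {E : Type*} [NormedAddCommGroup E] [NormedSpace ℂ E]
    [CompleteSpace E] {L : E →L[ℂ] E} (hL : ‖L‖ ≤ 1) (f : E) :
    ∃ w : ℂ → E, DifferentiableOn ℂ w (ball 0 1) ∧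
      ∀ z ∈ ball (0 : ℂ) 1, w z - z • L (w z) = f := by
  have hu : ∀ z ∈ ball (0 : ℂ) 1, IsUnit (1 - z • L) := fun z hz => by
    refine isUnit_one_sub_of_norm_lt_one ?_
    rw [norm_smul]
    rw [mem_ball_zero_iff] at hz
    exact mul_lt_one_of_nonneg_of_lt_one_left (norm_nonneg _) hz hL
  refine ⟨fun z => Ring.inverse (1 - z • L) f, fun z hz => ?_, fun z hz => ?_⟩
  · have h1 : DifferentiableAt ℂ (fun z : ℂ => (1 : E →L[ℂ] E) - z • L) z :=
      (differentiableAt_const _).sub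
        (DifferentiableAt.fun_smul differentiableAt_id (differentiableAt_const L))
    have h2 : DifferentiableAt ℂ (fun z : ℂ => Ring.inverse ((1 : E →L[ℂ] E) - z • L)) z :=
      DifferentiableAt.fun_comp' z (differentiableAt_inverse (𝕜 := ℂ) (hu z hz)) h1
    exact (h2.clm_apply (differentiableAt_const f)).differentiableWithinAt
  · have h := congrArg (fun A : E →L[ℂ] E => A f) (Ring.mul_inverse_cancel _ (hu z hz))
    simpa using h

/-! ### Reproducing kernels, the backward shift and bounded quotients. -/

namespace HardyH2

theorem coeffEquiv_kernel (l : 𝔻) (n : ℕ) : coeffEquiv (kernel l) n = conj (l : ℂ) ^ n := by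
  have h : coeffEquiv (kernel l) = ⟨fun n : ℕ => conj (l : ℂ) ^ n, memℓp_geometric l⟩ := by
    refine coeffEquiv_eq fun z => ?_
    have h : ‖conj (l : ℂ) * (z : ℂ)‖ < 1 := by
      rw [norm_mul, RCLike.norm_conj]
      exact mul_lt_one_of_nonneg_of_lt_one_left (norm_nonneg _) l.norm_lt_one z.norm_lt_one.le
    simpa [mul_pow, one_div, kernel_apply] using hasSum_geometric_of_norm_lt_one h
  rw [h]

theorem inner_eq_tsum (f g : HardyH2) :
    inner ℂ f g = ∑' n : ℕ, inner ℂ (coeffEquiv f n) (coeffEquiv g n) :=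
  lp.inner_eq_tsum (coeffEquiv f) (coeffEquiv g)

theorem inner_kernel_left (l : 𝔻) (f : HardyH2) : inner ℂ (kernel l) f = f l := by
  rw [inner_eq_tsum, ← (hasSum_coeff f l).tsum_eq]
  refine tsum_congr fun n => ?_
  rw [coeffEquiv_kernel]
  simp [RCLike.inner_apply]

theorem norm_sq_kernel (l : 𝔻) : ‖kernel l‖ ^ 2 = (1 - ‖(l : ℂ)‖ ^ 2)⁻¹ := by
  have h := inner_self_eq_norm_sq_to_K (𝕜 := ℂ) (kernel l)
  rw [inner_kernel_left, kernel_apply, mul_comm, Complex.mul_conj, Complex.normSq_eq_norm_sq] at h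
  have h2 : ((‖kernel l‖ ^ 2 : ℝ) : ℂ) = (((1 - ‖(l : ℂ)‖ ^ 2)⁻¹ : ℝ) : ℂ) := by
    push_cast
    push_cast at h
    rw [one_div] at h
    exact h.symm
  exact_mod_cast h2

theorem norm_kernel (l : 𝔻) : ‖kernel l‖ = 1 / (1 - ‖(l : ℂ)‖ ^ 2) ^ (1 / 2 : ℝ) := by
  have h := norm_sq_kernel l
  have hp : 0 < 1 - ‖(l : ℂ)‖ ^ 2 := sub_pos.2 l.sq_norm_lt_one
  rw [← Real.sqrt_eq_rpow, one_div, ← Real.sqrt_inv, ← h, Real.sqrt_sq (norm_nonneg _)]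

theorem kernel_zero_apply (z : 𝔻) : kernel 0 z = 1 := by simp [kernel_apply]

theorem eq_shift_of_apply_zero {f : HardyH2} (h : f 0 = 0) : ∃ g, f = shift g := by
  have h0 : coeffEquiv f 0 = 0 := by
    have h1 := hasSum_coeff f 0
    rw [h] at h1
    have h2 := hasSum_single (f := fun n : ℕ => coeffEquiv f n * ((0 : 𝔻) : ℂ) ^ n) 0
      fun n hn => by simp [hn]
    simpa using h2.unique h1
  have hm : Memℓp (fun n => coeffEquiv f (n + 1)) 2 := by
    refine memℓp_gen ?_
    exact (summable_nat_add_iff 1).2 ((memℓp_gen_iff (by norm_num)).1 (coeffEquiv f).2)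
  let b : SeqL2 := ⟨fun n => coeffEquiv f (n + 1), hm⟩
  refine ⟨ofCoeff b, coeffEquiv.injective ?_⟩
  rw [coeffEquiv_eq (f := shift (ofCoeff b)) (hasSum_shiftSeq _)]
  have hb : coeffEquiv (ofCoeff b) = b := coeffEquiv.apply_symm_apply b
  rw [hb]
  ext n
  cases n with
  | zero => exact h0
  | succ n => rfl

theorem adjoint_shift_shift (f : HardyH2) : ContinuousLinearMap.adjoint shift (shift f) = f := by
  let e : HardyH2 →ₗᵢ[ℂ] HardyH2 := ⟨shift.toLinearMap, norm_shift_apply⟩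
  refine ext_inner_right ℂ fun g => ?_
  rw [ContinuousLinearMap.adjoint_inner_left]
  exact e.inner_map_map f g

theorem adjoint_shift_kernel (l : 𝔻) :
    ContinuousLinearMap.adjoint shift (kernel l) = conj (l : ℂ) • kernel l := by
  refine ext_inner_right ℂ fun g => ?_
  rw [ContinuousLinearMap.adjoint_inner_left, inner_kernel_left, shift_apply, inner_smul_left,
    inner_kernel_left, Complex.conj_conj]

theorem shift_adjoint_shift (f : HardyH2) :
    shift (ContinuousLinearMap.adjoint shift f) = f - f 0 • kernel 0 := by
  have h0 : (f - f 0 • kernel 0) 0 = 0 := by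
    have := (inner_kernel_left 0 (f - f 0 • kernel 0)).symm
    rw [inner_sub_right, inner_smul_right, inner_kernel_left, inner_kernel_left,
      kernel_zero_apply] at this
    simpa using this
  obtain ⟨g, hg⟩ := eq_shift_of_apply_zero h0
  have h1 : f = f 0 • kernel 0 + shift g := by rw [← hg]; abel
  have h2 : ContinuousLinearMap.adjoint shift f = g := by
    rw [h1, map_add, map_smul, adjoint_shift_kernel, adjoint_shift_shift]
    simp
  rw [h2, hg]

theorem norm_sq_adjoint_shift (f : HardyH2) :
    ‖ContinuousLinearMap.adjoint shift f‖ ^ 2 = ‖f‖ ^ 2 - ‖f 0‖ ^ 2 := by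
  rw [← norm_shift_apply (ContinuousLinearMap.adjoint shift f)]
  have h := norm_add_sq (𝕜 := ℂ) (shift (ContinuousLinearMap.adjoint shift f)) (f 0 • kernel 0)
  have h1 : shift (ContinuousLinearMap.adjoint shift f) + f 0 • kernel 0 = f := by
    rw [shift_adjoint_shift]; abel
  have h2 : inner ℂ (shift (ContinuousLinearMap.adjoint shift f)) (f 0 • kernel 0) = 0 := by
    rw [← ContinuousLinearMap.adjoint_inner_right, map_smul, adjoint_shift_kernel]
    simp
  rw [h1, h2, norm_smul] at h
  have h3 : ‖kernel 0‖ ^ 2 = 1 := by rw [norm_sq_kernel]; simp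
  rw [mul_pow, h3] at h
  simp at h
  linarith

/-- A function in `H²` is a quotient of bounded holomorphic functions. -/
theorem exists_bounded_quotient (f : HardyH2) :
    ∃ a b : ℂ → ℂ, DifferentiableOn ℂ a (ball 0 1) ∧ DifferentiableOn ℂ b (ball 0 1) ∧
      (∀ z ∈ ball (0 : ℂ) 1, ‖a z‖ ≤ 1) ∧ (∀ z ∈ ball (0 : ℂ) 1, ‖b z‖ ≤ 1) ∧ b 0 ≠ 0 ∧
      ∀ z : 𝔻, a z = b z * f z := by
  let L : HardyH2 →L[ℂ] HardyH2 := ContinuousLinearMap.adjoint shift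
  have hL : ‖L‖ ≤ 1 := by
    refine (LinearIsometryEquiv.norm_map ContinuousLinearMap.adjoint shift).le.trans ?_
    exact ContinuousLinearMap.opNorm_le_bound _ zero_le_one fun f => by
      rw [norm_shift_apply, one_mul]
  -- With `w z = (1 - z S*)⁻¹ f`, the constant term of `w z` is `f z`. The function `G` below has
  -- real part `‖w z‖² - |z|² ‖S* (w z)‖²`, which dominates `|f z|²`; so `(1 + G)⁻¹` is a bounded
  -- denominator for `f`.
  obtain ⟨w, hwd, hw⟩ := exists_resolvent_apply hL f
  have hw0 : ∀ z : 𝔻, w z 0 = f z := fun z => by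
    have hz : (z : ℂ) ∈ ball (0 : ℂ) 1 := by simpa using z.norm_lt_one
    have h1 := congrArg (fun g => inner ℂ (kernel z) g) (hw z hz)
    have h2 := congrArg (fun g => inner ℂ (kernel z) g) (shift_adjoint_shift (w z))
    simp only [inner_sub_right, inner_smul_right, inner_kernel_left, shift_apply,
      kernel_zero_apply] at h1 h2
    change (z : ℂ) * (L (w z)) z = _ at h2
    rw [h2] at h1
    rw [← h1]; ring
  let G : ℂ → ℂ := fun z => inner ℂ f ((2 : ℂ) • w z - f)
  have hGd : DifferentiableOn ℂ G (ball 0 1) := by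
    have h : DifferentiableOn ℂ (fun z => innerSL ℂ f ((2 : ℂ) • w z - f)) (ball 0 1) :=
      (innerSL ℂ f).differentiable.comp_differentiableOn ((hwd.const_smul (2 : ℂ)).sub_const f)
    exact h
  have hGre : ∀ z ∈ ball (0 : ℂ) 1, ‖w z 0‖ ^ 2 ≤ (G z).re := fun z hz => by
    have h1 : G z = inner ℂ (w z - z • L (w z)) (w z + z • L (w z)) := by
      change inner ℂ f ((2 : ℂ) • w z - f) = _
      have h : (2 : ℂ) • w z - f = w z + z • L (w z) := by
        rw [← hw z hz]
        rw [two_smul]; abel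
      rw [h, hw z hz]
    have h2 : (G z).re = ‖w z‖ ^ 2 - ‖z‖ ^ 2 * ‖L (w z)‖ ^ 2 := by
      have h3 : RCLike.re (inner ℂ (w z) (z • L (w z))) = RCLike.re (inner ℂ (z • L (w z)) (w z)) :=
        inner_re_symm _ _
      rw [h1, inner_sub_left, inner_add_right, inner_add_right, inner_self_eq_norm_sq_to_K,
        inner_self_eq_norm_sq_to_K, norm_smul]
      simp only [RCLike.re_to_complex] at h3
      simp only [Complex.sub_re, Complex.add_re, h3]
      have : ∀ x : ℝ, ((x : ℂ) ^ 2).re = x ^ 2 := fun x => by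
        rw [← Complex.ofReal_pow, Complex.ofReal_re]
      simp only [Complex.coe_algebraMap, this]
      ring
    rw [h2, norm_sq_adjoint_shift]
    rw [mem_ball_zero_iff] at hz
    have h4 := norm_sq_adjoint_shift (w z)
    have h5 : ‖z‖ ^ 2 ≤ 1 := by nlinarith [norm_nonneg z]
    have h6 := sq_nonneg ‖ContinuousLinearMap.adjoint shift (w z)‖
    nlinarith
  have hG1 : ∀ z ∈ ball (0 : ℂ) 1, 1 + ‖w z 0‖ ^ 2 ≤ ‖1 + G z‖ := fun z hz => by
    refine le_trans ?_ (Complex.re_le_norm _)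
    simpa using hGre z hz
  have hG0 : ∀ z ∈ ball (0 : ℂ) 1, 1 + G z ≠ 0 := fun z hz h => by
    have := hG1 z hz
    rw [h, norm_zero] at this
    nlinarith [sq_nonneg ‖w z 0‖]
  have hFd : DifferentiableOn ℂ (fun z => w z 0) (ball 0 1) := by
    have h : DifferentiableOn ℂ (fun z => innerSL ℂ (kernel 0) (w z)) (ball 0 1) :=
      (innerSL ℂ (kernel 0)).differentiable.comp_differentiableOn hwd
    exact h.congr fun z _ => (inner_kernel_left 0 (w z)).symm
  have hbd : DifferentiableOn ℂ (fun z => (1 + G z)⁻¹) (ball 0 1) :=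
    (hGd.const_add 1).inv hG0
  refine ⟨fun z => (1 + G z)⁻¹ * w z 0, fun z => (1 + G z)⁻¹, hbd.mul hFd, hbd, fun z hz => ?_,
    fun z hz => ?_, inv_ne_zero (hG0 0 (by simp)), fun z => by simp only [hw0]⟩
  · rw [norm_mul, norm_inv]
    refine inv_mul_le_one_of_le₀ ?_ (norm_nonneg _)
    nlinarith [hG1 z hz, sq_nonneg (‖w z 0‖ - 1), norm_nonneg (w z 0)]
  · rw [norm_inv]
    refine inv_le_one_of_one_le₀ ?_
    nlinarith [hG1 z hz, sq_nonneg ‖w z 0‖]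

end HardyH2

/-! ### Polynomial approximation, weak limits and Hilbert dimension. -/

/-- A bounded holomorphic function on the disc is a pointwise limit of polynomials that are
uniformly bounded on the disc. -/
theorem exists_polynomial_tendsto {φ : ℂ → ℂ} {M : ℝ} (hd : DifferentiableOn ℂ φ (ball 0 1))
    (hM : ∀ z ∈ ball (0 : ℂ) 1, ‖φ z‖ ≤ M) :
    ∃ p : ℕ → Polynomial ℂ, (∀ n, ∀ z ∈ closedBall (0 : ℂ) 1, ‖(p n).eval z‖ ≤ M + 1) ∧
      ∀ z ∈ ball (0 : ℂ) 1, Tendsto (fun n => (p n).eval z) atTop (𝓝 (φ z)) := by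
  have key : ∀ ρ : ℝ, 0 < ρ → ρ < 1 → ∀ ε > 0, ∃ p : Polynomial ℂ, ∀ z ∈ closedBall (0 : ℂ) 1,
      ‖φ (ρ * z) - p.eval z‖ < ε := by
    intro ρ h0 h1 ε hε
    -- Taylor sums of `φ` converge uniformly on the ball of radius `τ < σ < 1`, and this ball
    -- contains `ρ` times the closed unit disc since `ρ < τ`.
    obtain ⟨σ, hσ1, hσ2⟩ := exists_between h1
    obtain ⟨τ, hτ1, hτ2⟩ := exists_between hσ1
    have hσ0 : 0 < σ := h0.trans hσ1
    have hτ0 : 0 < τ := h0.trans hτ1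
    lift σ to NNReal using hσ0.le
    lift τ to NNReal using hτ0.le
    have hp := (hd.mono (closedBall_subset_ball hσ2)).hasFPowerSeriesOnBall
      (by exact_mod_cast hσ0)
    have hu := hp.tendstoUniformlyOn (r' := τ) (by exact_mod_cast hτ2)
    obtain ⟨N, hN⟩ := ((Metric.tendstoUniformlyOn_iff.1 hu) ε hε).exists
    refine ⟨∑ k ∈ Finset.range N, Polynomial.monomial k
      ((cauchyPowerSeries φ 0 σ).coeff k * ρ ^ k), fun z hz => ?_⟩
    have hz' : (ρ * z : ℂ) ∈ ball (0 : ℂ) τ := by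
      rw [mem_closedBall_zero_iff] at hz
      rw [mem_ball_zero_iff, norm_mul, Complex.norm_real, Real.norm_of_nonneg h0.le]
      nlinarith
    have h := hN _ hz'
    rw [zero_add, dist_eq_norm] at h
    suffices hs : Polynomial.eval z (∑ k ∈ Finset.range N, Polynomial.monomial k
        ((cauchyPowerSeries φ 0 σ).coeff k * ρ ^ k)) =
        (cauchyPowerSeries φ 0 σ).partialSum N (ρ * z) by rwa [hs]
    rw [Polynomial.eval_finsetSum, FormalMultilinearSeries.partialSum]
    refine Finset.sum_congr rfl fun k _ => ?_
    rw [FormalMultilinearSeries.apply_eq_prod_smul_coeff]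
    simp [mul_pow]
    ring
  have hρ : ∀ n : ℕ, 0 < 1 - 1 / ((n : ℝ) + 2) ∧ 1 - 1 / ((n : ℝ) + 2) < 1 := fun n => by
    have : 1 / ((n : ℝ) + 2) < 1 := by
      rw [div_lt_one (by positivity)]
      linarith [n.cast_nonneg (α := ℝ)]
    have h2 : 0 < 1 / ((n : ℝ) + 2) := by positivity
    constructor <;> linarith
  choose p hp using fun n : ℕ => key _ (hρ n).1 (hρ n).2 (1 / ((n : ℝ) + 1)) (by positivity)
  have ht : Tendsto (fun n : ℕ => 1 / ((n : ℝ) + 1)) atTop (𝓝 0) :=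
    tendsto_one_div_add_atTop_nhds_zero_nat
  refine ⟨p, fun n z hz => ?_, fun z hz => ?_⟩
  · have h1 := (hp n z hz).le
    have h2 : ‖φ ((1 - 1 / ((n : ℝ) + 2) : ℝ) * z)‖ ≤ M := by
      refine hM _ ?_
      rw [mem_closedBall_zero_iff] at hz
      rw [mem_ball_zero_iff, norm_mul, Complex.norm_real, Real.norm_of_nonneg (hρ n).1.le]
      nlinarith [hρ n, norm_nonneg z]
    have h3 : 1 / ((n : ℝ) + 1) ≤ 1 := by
      rw [div_le_one (by positivity)]; linarith [n.cast_nonneg (α := ℝ)]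
    have h4 := norm_sub_norm_le ((p n).eval z) (φ ((1 - 1 / ((n : ℝ) + 2) : ℝ) * z))
    rw [norm_sub_rev] at h4
    linarith
  · have hr : Tendsto (fun n : ℕ => ((1 - 1 / ((n : ℝ) + 2) : ℝ) : ℂ) * z) atTop (𝓝 z) := by
      have h1 : Tendsto (fun n : ℕ => 1 - 1 / ((n : ℝ) + 2)) atTop (𝓝 (1 - 0)) := by
        refine tendsto_const_nhds.sub ?_
        have := (tendsto_add_atTop_iff_nat 1).2 ht
        refine this.congr fun n => ?_
        push_cast; ring
      have h2 := ((Complex.continuous_ofReal.tendsto _).comp h1).mul_const z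
      simpa using h2
    have h1 : Tendsto (fun n : ℕ => φ (((1 - 1 / ((n : ℝ) + 2) : ℝ) : ℂ) * z)) atTop (𝓝 (φ z)) :=
      ((hd.continuousOn.continuousAt (isOpen_ball.mem_nhds hz)).tendsto).comp hr
    have h2 : Tendsto (fun n : ℕ => φ (((1 - 1 / ((n : ℝ) + 2) : ℝ) : ℂ) * z) - (p n).eval z)
        atTop (𝓝 0) :=
      squeeze_zero_norm (fun n => (hp n z (ball_subset_closedBall hz)).le) ht
    simpa using h1.sub h2

/-- Bounded sequences in a Hilbert space have weak cluster points. -/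
theorem exists_inner_eq_of_tendsto {H : Type*} [NormedAddCommGroup H] [InnerProductSpace ℂ H]
    [CompleteSpace H] (y : ℕ → H) (R : ℝ) (hy : ∀ n, ‖y n‖ ≤ R) :
    ∃ x : H, ∀ v : H, ∀ c : ℂ, Tendsto (fun n => inner ℂ (y n) v) atTop (𝓝 c) →
      inner ℂ x v = c := by
  let F : ℕ → WeakDual ℂ H := fun n => StrongDual.toWeakDual (InnerProductSpace.toDual ℂ H (y n))
  have hc := WeakDual.isCompact_closedBall (𝕜 := ℂ) (E := H) 0 R
  have hF : ∀ n, F n ∈ WeakDual.toStrongDual ⁻¹' closedBall (0 : StrongDual ℂ H) R := fun n => by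
    simpa [F] using hy n
  -- A limit along an ultrafilter finer than `atTop` exists by compactness and agrees with every
  -- ordinary limit.
  let U : Ultrafilter ℕ := Ultrafilter.of atTop
  have hU : (U : Filter ℕ) ≤ atTop := Ultrafilter.of_le atTop
  obtain ⟨ℓ, -, hℓ⟩ := hc.ultrafilter_le_nhds (U.map F) (by
    rw [le_principal_iff, Ultrafilter.mem_coe, Ultrafilter.mem_map]
    exact Filter.univ_mem' hF)
  refine ⟨(InnerProductSpace.toDual ℂ H).symm (WeakDual.toStrongDual ℓ), fun v c hv => ?_⟩
  rw [InnerProductSpace.toDual_symm_apply]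
  have h1 : Tendsto (fun n => F n v) U (𝓝 (ℓ v)) :=
    ((WeakDual.eval_continuous v).tendsto ℓ).comp hℓ
  exact tendsto_nhds_unique h1 (hv.mono_left hU)

/-- A complete orthogonal family of nonzero vectors determines the Hilbert space dimension. -/
theorem hasHilbertDim_of_orthogonal {E : Type*} [NormedAddCommGroup E] [InnerProductSpace ℂ E]
    [CompleteSpace E] {κ : Type} (v : κ → E) (h0 : ∀ k, v k ≠ 0)
    (ho : ∀ k l, k ≠ l → inner ℂ (v k) (v l) = 0)
    (hc : ∀ u, (∀ k, inner ℂ (v k) u = 0) → u = 0) : HasHilbertDim E (Cardinal.mk κ) := by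
  have he : Orthonormal ℂ (fun k => ((‖v k‖ : ℂ)⁻¹) • v k) := by
    refine ⟨fun k => ?_, fun k l h => ?_⟩
    · rw [norm_smul, norm_inv, Complex.norm_real, norm_norm,
        inv_mul_cancel₀ (norm_ne_zero_iff.2 (h0 k))]
    · change inner ℂ (((‖v k‖ : ℂ)⁻¹) • v k) (((‖v l‖ : ℂ)⁻¹) • v l) = 0
      rw [inner_smul_left, inner_smul_right, ho k l h, mul_zero, mul_zero]
  refine ⟨κ, ⟨HilbertBasis.mkOfOrthogonalEqBot he ?_⟩, rfl⟩
  rw [Submodule.eq_bot_iff]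
  refine fun u hu => hc u fun k => ?_
  have h1 := (Submodule.mem_orthogonal _ _).1 hu _ (Submodule.subset_span ⟨k, rfl⟩)
  rw [inner_smul_left] at h1
  exact (mul_eq_zero.1 h1).resolve_left (by simpa using h0 k)

/-! ### Polynomially bounded operators: the kernel of the adjoint is a line. -/

section PolynomiallyBounded

variable {H : Type*} [NormedAddCommGroup H] [InnerProductSpace ℂ H]
  {T : H →L[ℂ] H} {X : H →L[ℂ] HardyH2}

theorem intertwining_aeval_apply (hXT : X ∘L T = HardyH2.shift ∘L X) (p : Polynomial ℂ) (x : H)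
    (z : 𝔻) : X (Polynomial.aeval T p x) z = p.eval (z : ℂ) * X x z := by
  have hT : ∀ y, X (T y) = HardyH2.shift (X y) := fun y => congrArg (fun A : H →L[ℂ] HardyH2 => A y) hXT
  induction p using Polynomial.induction_on' with
  | add p q hp hq => simp [hp, hq, add_mul]
  | monomial n c =>
    have h : ∀ n : ℕ, X ((T ^ n) x) z = (z : ℂ) ^ n * X x z := fun n => by
      induction n with
      | zero => simp
      | succ n ih => rw [pow_succ', mul_apply_eq_comp, hT, HardyH2.shift_apply, ih]; ring
    rw [Polynomial.aeval_monomial, Polynomial.eval_monomial, mul_apply_eq_comp,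
      Algebra.algebraMap_eq_smul_one, smul_apply, map_smul,
      HardyH2.smul_apply, one_apply_eq_self, h]
    ring

theorem exists_apply_zero_ne_zero (hX : DenseRange X) : ∃ g : H, X g 0 ≠ 0 := by
  by_contra! h
  have h1 : HardyH2.kernel 0 = 0 := hX.eq_zero_of_inner_left ℂ fun g => by
    rw [HardyH2.inner_kernel_left, h]
  have h2 := HardyH2.kernel_zero_apply 0
  rw [h1] at h2
  exact zero_ne_one h2

variable [CompleteSpace H]

/-- The `H^∞` calculus of a polynomially bounded operator that is intertwined with the shift. -/
theorem IsPolynomiallyBounded.exists_apply_eq_mul (hT : IsPolynomiallyBounded T)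
    (hXT : X ∘L T = HardyH2.shift ∘L X) {φ : ℂ → ℂ} {M : ℝ}
    (hd : DifferentiableOn ℂ φ (ball 0 1)) (hM : ∀ z ∈ ball (0 : ℂ) 1, ‖φ z‖ ≤ M) (x : H) :
    ∃ y : H, ∀ z : 𝔻, X y z = φ z * X x z := by
  obtain ⟨C, hC, hT⟩ := hT
  obtain ⟨p, hp, hpt⟩ := exists_polynomial_tendsto hd hM
  obtain ⟨y, hy⟩ := exists_inner_eq_of_tendsto (fun n => Polynomial.aeval T (p n) x)
    (C * (M + 1) * ‖x‖) fun n => by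
      refine (ContinuousLinearMap.le_opNorm _ _).trans ?_
      refine mul_le_mul_of_nonneg_right ((hT (p n)).trans ?_) (norm_nonneg _)
      refine mul_le_mul_of_nonneg_left (csSup_le ?_ ?_) hC.le
      · exact ⟨_, 0, by simp, rfl⟩
      · rintro _ ⟨z, hz, rfl⟩
        exact hp n z hz
  refine ⟨y, fun z => ?_⟩
  have hz : (z : ℂ) ∈ ball (0 : ℂ) 1 := by simpa using z.norm_lt_one
  have hv : ∀ w : H, inner ℂ w (ContinuousLinearMap.adjoint X (HardyH2.kernel z)) = conj (X w z) :=
    fun w => by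
      rw [ContinuousLinearMap.adjoint_inner_right, ← inner_conj_symm, HardyH2.inner_kernel_left]
  have h := hy (ContinuousLinearMap.adjoint X (HardyH2.kernel z)) (conj (φ z * X x z)) (by
    simp only [hv, intertwining_aeval_apply hXT]
    exact (Complex.continuous_conj.tendsto _).comp ((hpt z hz).mul_const _))
  rw [hv] at h
  exact (starRingEnd ℂ).injective h

/-- Write `φ = φ(0) + z ψ`. Then `ψ` is bounded by the Schwarz lemma (the constant `2` bounds `φ -
φ(0)`), so `ψ · X x = X v` for some `v`, and injectivity of `X` gives `y = φ(0) x + T v`. The vector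
`u` is orthogonal to `T v`. -/
theorem IsPolynomiallyBounded.inner_eq_of_mem_ker_adjoint (hT : IsPolynomiallyBounded T)
    (hX : Function.Injective X) (hXT : X ∘L T = HardyH2.shift ∘L X) {φ : ℂ → ℂ}
    (hd : DifferentiableOn ℂ φ (ball 0 1)) (hM : ∀ z ∈ ball (0 : ℂ) 1, ‖φ z‖ ≤ 1) {u x y : H}
    (hu : ContinuousLinearMap.adjoint T u = 0) (hy : ∀ z : 𝔻, X y z = φ z * X x z) :
    inner ℂ u y = φ 0 * inner ℂ u x := by
  have h0 : (0 : ℂ) ∈ ball (0 : ℂ) 1 := by simp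
  have hψd : DifferentiableOn ℂ (dslope φ 0) (ball 0 1) :=
    (Complex.differentiableOn_dslope (isOpen_ball.mem_nhds h0)).2 hd
  have hψM : ∀ z ∈ ball (0 : ℂ) 1, ‖dslope φ 0 z‖ ≤ 2 / 1 := fun z hz =>
    Complex.norm_dslope_le_div_of_mapsTo_ball hd (fun w hw => by
      rw [mem_closedBall, dist_eq_norm]
      exact (norm_sub_le _ _).trans (by linarith [hM w hw, hM 0 h0])) hz
  obtain ⟨v, hv⟩ := hT.exists_apply_eq_mul hXT hψd hψM x
  have h : y = φ 0 • x + T v := hX (HardyH2.ext fun z => by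
    have h1 : X (T v) = HardyH2.shift (X v) := congrArg (fun A : H →L[ℂ] HardyH2 => A v) hXT
    have h2 := sub_smul_dslope φ 0 (z : ℂ)
    rw [sub_zero, smul_eq_mul] at h2
    rw [hy, map_add, map_smul, HardyH2.add_apply, HardyH2.smul_apply, h1, HardyH2.shift_apply, hv,
      ← mul_assoc, h2]
    ring)
  rw [h, inner_add_right, inner_smul_right, ← ContinuousLinearMap.adjoint_inner_left, hu,
    inner_zero_left, add_zero]

theorem IsPolynomiallyBounded.inner_eq_zero_of_apply_zero (hT : IsPolynomiallyBounded T)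
    (hX : IsQuasiaffinity X) (hXT : X ∘L T = HardyH2.shift ∘L X) {u x : H}
    (hu : ContinuousLinearMap.adjoint T u = 0) (hx : X x 0 = 0) : inner ℂ u x = 0 := by
  obtain ⟨g, hg⟩ := exists_apply_zero_ne_zero hX.2
  obtain ⟨a, b, had, hbd, ha, hb, hb0, hab⟩ := HardyH2.exists_bounded_quotient (X x)
  obtain ⟨c, d, hcd, hdd, hc, hd, hd0, hcd'⟩ := HardyH2.exists_bounded_quotient (X g)
  have hcb : ∀ z ∈ ball (0 : ℂ) 1, ‖c z * b z‖ ≤ 1 := fun z hz => by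
    rw [norm_mul]; exact mul_le_one₀ (hc z hz) (norm_nonneg _) (hb z hz)
  have had' : ∀ z ∈ ball (0 : ℂ) 1, ‖a z * d z‖ ≤ 1 := fun z hz => by
    rw [norm_mul]; exact mul_le_one₀ (ha z hz) (norm_nonneg _) (hd z hz)
  obtain ⟨y₁, hy₁⟩ := hT.exists_apply_eq_mul hXT (hcd.mul hbd) hcb x
  obtain ⟨y₂, hy₂⟩ := hT.exists_apply_eq_mul hXT (had.mul hdd) had' g
  -- Both have the image `b d · X x · X g`, since `a = b · X x` and `c = d · X g`.
  have h : y₁ = y₂ := hX.1 (HardyH2.ext fun z => by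
    rw [hy₁, hy₂]
    simp only [Pi.mul_apply, hab, hcd']
    ring)
  have h1 := hT.inner_eq_of_mem_ker_adjoint hX.1 hXT (hcd.mul hbd) hcb hu hy₁
  have h2 := hT.inner_eq_of_mem_ker_adjoint hX.1 hXT (had.mul hdd) had' hu hy₂
  have ha0 := hab 0
  have hc0 := hcd' 0
  rw [Complex.UnitDisc.coe_zero] at ha0 hc0
  rw [h, h2] at h1
  simp only [Pi.mul_apply, ha0, hx, mul_zero, zero_mul] at h1
  refine (mul_eq_zero.1 h1.symm).resolve_left (mul_ne_zero ?_ hb0)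
  rw [hc0]
  exact mul_ne_zero hd0 hg

/-- The vector `v = X* h_0` represents `x ↦ (X x)(0)`, so an element of the kernel that is
orthogonal to `v` is orthogonal to itself by `inner_eq_zero_of_apply_zero`. -/
theorem IsPolynomiallyBounded.hasHilbertDim_ker_adjoint (hT : IsPolynomiallyBounded T)
    (hX : IsQuasiaffinity X) (hXT : X ∘L T = HardyH2.shift ∘L X) :
    HasHilbertDim (ContinuousLinearMap.adjoint T).ker 1 := by
  set v : H := ContinuousLinearMap.adjoint X (HardyH2.kernel 0) with hv
  have hvx : ∀ x, inner ℂ v x = X x 0 := fun x => by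
    rw [hv, ContinuousLinearMap.adjoint_inner_left, HardyH2.inner_kernel_left]
  have hvk : v ∈ (ContinuousLinearMap.adjoint T).ker := by
    rw [LinearMap.mem_ker]
    refine ext_inner_right ℂ fun x => ?_
    have h1 : X (T x) = HardyH2.shift (X x) := congrArg (fun A : H →L[ℂ] HardyH2 => A x) hXT
    erw [ContinuousLinearMap.adjoint_inner_left]
    rw [hvx, h1, HardyH2.shift_apply]
    simp
  have hv0 : v ≠ 0 := fun h => by
    obtain ⟨g, hg⟩ := exists_apply_zero_ne_zero hX.2
    rw [← hvx, h, inner_zero_left] at hg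
    exact hg rfl
  have h := hasHilbertDim_of_orthogonal (fun _ : Unit => (⟨v, hvk⟩ : (ContinuousLinearMap.adjoint T).ker))
    (fun _ h => hv0 (congrArg Subtype.val h)) (fun k l h => (h (Subsingleton.elim k l)).elim)
    fun u hu => Subtype.ext ((inner_self_eq_zero (𝕜 := ℂ)).1
      (hT.inner_eq_zero_of_apply_zero hX hXT (LinearMap.mem_ker.1 u.2)
        ((hvx u).symm.trans (hu ()))))
  simpa using h

end PolynomiallyBounded

/-! ### Contractions of `ℓ²` given by injective partial maps of indices. -/

section SquareSummable

theorem sum_partialComp_le {J J' : Type*} {σ : J → Option J'}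
    (hσ : ∀ j₁ j₂ i, σ j₁ = some i → σ j₂ = some i → j₁ = j₂) (a : lp (fun _ : J' => ℂ) 2)
    (s : Finset J) : ∑ j ∈ s, ‖(σ j).elim 0 (fun i => a i)‖ ^ (2 : ENNReal).toReal ≤
      ‖a‖ ^ (2 : ENNReal).toReal := by
  classical
  have h1 : ∑ j ∈ s, ‖(σ j).elim 0 (fun i => a i)‖ ^ (2 : ENNReal).toReal =
      ∑ j ∈ s.filter (fun j => σ j ≠ none),
        Option.elim' 0 (fun i => ‖a i‖ ^ (2 : ENNReal).toReal) (σ j) := by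
    rw [Finset.sum_filter]
    refine Finset.sum_congr rfl fun j _ => ?_
    cases h : σ j <;> simp
  rw [h1, ← Finset.sum_image (f := Option.elim' 0 (fun i => ‖a i‖ ^ (2 : ENNReal).toReal))
    (g := σ), ← Finset.sum_eraseNone]
  · exact lp.sum_rpow_le_norm_rpow (by norm_num) a _
  · intro j₁ h₁ j₂ h₂ h
    obtain ⟨i, hi⟩ := Option.ne_none_iff_exists'.1 (Finset.mem_filter.1 h₁).2
    exact hσ j₁ j₂ i hi (h ▸ hi)

/-- The operator between spaces of square summable families that is given by composition with an
injective partial function. -/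
def lpPartialComp {J J' : Type*} (σ : J → Option J')
    (hσ : ∀ j₁ j₂ i, σ j₁ = some i → σ j₂ = some i → j₁ = j₂) :
    lp (fun _ : J' => ℂ) 2 →L[ℂ] lp (fun _ : J => ℂ) 2 :=
  LinearMap.mkContinuous
    { toFun := fun a => ⟨fun j => (σ j).elim 0 (fun i => a i), memℓp_gen' (sum_partialComp_le hσ a)⟩
      map_add' := fun a b => by
        ext j
        change (σ j).elim 0 (fun i => (a + b) i) =
          (σ j).elim 0 (fun i => a i) + (σ j).elim 0 (fun i => b i)
        cases σ j <;> simp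
      map_smul' := fun c a => by
        ext j
        change (σ j).elim 0 (fun i => (c • a) i) = c * (σ j).elim 0 (fun i => a i)
        cases σ j <;> simp } 1 fun a => by
      rw [one_mul]
      exact lp.norm_le_of_forall_sum_le (by norm_num) (norm_nonneg _) (sum_partialComp_le hσ a)

variable {J J' : Type*} {σ : J → Option J'}
  {hσ : ∀ j₁ j₂ i, σ j₁ = some i → σ j₂ = some i → j₁ = j₂}

theorem lpPartialComp_apply (a : lp (fun _ : J' => ℂ) 2) (j : J) :
    lpPartialComp σ hσ a j = (σ j).elim 0 (fun i => a i) := rfl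

theorem norm_lpPartialComp_apply_le (a : lp (fun _ : J' => ℂ) 2) :
    ‖lpPartialComp σ hσ a‖ ≤ ‖a‖ :=
  lp.norm_le_of_forall_sum_le (by norm_num) (norm_nonneg _) (sum_partialComp_le hσ a)

theorem separableSpace_lp [Countable J] :
    TopologicalSpace.SeparableSpace (lp (fun _ : J => ℂ) 2) := by
  classical
  let v : J → lp (fun _ : J => ℂ) 2 := fun i => lp.single 2 i 1
  have h := ((Set.countable_range v).isSeparable.span (R := ℂ)).closure
  rw [← TopologicalSpace.isSeparable_univ_iff]
  refine h.mono fun a _ => ?_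
  have ha := lp.hasSum_single (by norm_num : (2 : ENNReal) ≠ ⊤) a
  refine mem_closure_of_tendsto ha (Eventually.of_forall fun s => ?_)
  refine Submodule.sum_mem _ fun i _ => ?_
  have : lp.single 2 i (a i) = a i • v i := by
    rw [← lp.single_smul]; simp
  change lp.single 2 i (a i) ∈ Submodule.span ℂ (Set.range v)
  rw [this]
  exact Submodule.smul_mem _ _ (Submodule.subset_span ⟨i, rfl⟩)

end SquareSummable

/-! ### The space: windows, tails and branch coordinates. -/

namespace BranchedShift

/-- The coordinates of the space on which the operator acts: branches, Taylor coefficients, and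
tails of the branches. -/
inductive Coord (ι : Type) : Type
  | branch (p : ι) : Coord ι
  | coeff (i : ℕ) : Coord ι
  | tail (p : ι) (q j : ℕ) : Coord ι

open Coord

instance (ι : Type) : DecidableEq (Coord ι) := Classical.decEq _

instance (ι : Type) [Countable ι] : Countable (Coord ι) := by
  let f : Coord ι → ι ⊕ ℕ ⊕ (ι × ℕ × ℕ) := fun
    | branch p => .inl p
    | coeff i => .inr (.inl i)
    | tail p q j => .inr (.inr (p, q, j))
  have hf : Function.Injective f := by
    rintro (p | i | ⟨p, q, j⟩) (p' | i' | ⟨p', q', j'⟩) h <;> simp_all [f]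
  exact hf.countable

/-- Square summable families of coordinates. -/
abbrev Ambient (ι : Type) : Type := lp (fun _ : Coord ι => ℂ) 2

variable {ι : Type}

theorem continuous_apply (i : Coord ι) : Continuous fun x : Ambient ι => x i :=
  (lp.evalCLM ℂ (fun _ : Coord ι => ℂ) 2 i).continuous

/-- The Taylor coefficients of an element. -/
def coeffs : Ambient ι →L[ℂ] SeqL2 :=
  lpPartialComp (fun i : ℕ => some (coeff i)) fun _ _ _ h₁ h₂ => by
    rw [← h₁] at h₂
    simpa using h₂.symm

theorem coeffs_apply (x : Ambient ι) (i : ℕ) : coeffs x i = x (coeff i) := rfl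

/-- The part of the powers of the operator that moves coefficients and tails. -/
def moveFun (n : ℕ) : Coord ι → Option (Coord ι)
  | branch _ => none
  | coeff i => if n ≤ i then some (coeff (i - n)) else none
  | tail p q j => some (tail p q (j + n))

theorem moveFun_injective (n : ℕ) (j₁ j₂ i : Coord ι) (h₁ : moveFun n j₁ = some i)
    (h₂ : moveFun n j₂ = some i) : j₁ = j₂ := by
  rcases j₁ with p | i₁ | ⟨p, q, j⟩ <;> rcases j₂ with p' | i₂ | ⟨p', q', j'⟩ <;>
    simp only [moveFun, reduceCtorEq, Option.some.injEq, Option.ite_none_right_eq_some] at h₁ h₂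
  · obtain ⟨h₁, rfl⟩ := h₁
    obtain ⟨h₂, h⟩ := h₂
    rw [coeff.injEq] at h ⊢
    omega
  · obtain ⟨_, rfl⟩ := h₁
    simp at h₂
  · obtain ⟨_, rfl⟩ := h₂
    simp at h₁
  · subst h₁
    simp only [tail.injEq, Nat.add_right_cancel_iff] at h₂ ⊢
    exact ⟨h₂.1.symm, h₂.2.1.symm, h₂.2.2.symm⟩

theorem inner_single_one_left (i : Coord ι) (x : Ambient ι) :
    inner ℂ (lp.single 2 i 1 : Ambient ι) x = x i := by
  rw [lp.inner_single_left]
  simp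

/-- The index of a Taylor coefficient. -/
def coeffIndex : Coord ι → Option ℕ
  | branch _ => none
  | coeff i => some i
  | tail _ _ _ => none

theorem coeffIndex_injective (c₁ c₂ : Coord ι) (i : ℕ) (h₁ : coeffIndex c₁ = some i)
    (h₂ : coeffIndex c₂ = some i) : c₁ = c₂ := by
  rcases c₁ with p | i₁ | ⟨p, q, j⟩ <;> rcases c₂ with p' | i₂ | ⟨p', q', j'⟩ <;>
    simp_all [coeffIndex]

/-- The element of the ambient space with given Taylor coefficients and no other coordinates. -/
def ofCoeffs (ι : Type) : SeqL2 →L[ℂ] Ambient ι :=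
  lpPartialComp coeffIndex coeffIndex_injective

variable [Encodable ι]

/-- The indices `i` with `3 * len p q r ≤ i ≤ 4 * len p q r` form a window. -/
def len (p : ι) (q r : ℕ) : ℕ := 4 ^ Encodable.encode (p, q, r)

theorem len_pos (p : ι) (q r : ℕ) : 0 < len p q r := by unfold len; positivity

/-- Lengths are powers of four with distinct exponents; this factor-four gap is behind every
disjointness statement about windows. -/
theorem len_trichotomy (p p' : ι) (q r q' r' : ℕ) :
    (p = p' ∧ q = q' ∧ r = r') ∨ 4 * len p q r ≤ len p' q' r' ∨ 4 * len p' q' r' ≤ len p q r := by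
  have h4 : ∀ m n : ℕ, m < n → 4 * 4 ^ m ≤ 4 ^ n := fun m n h => by
    rw [← pow_succ']
    exact Nat.pow_le_pow_right (by norm_num) h
  rcases lt_trichotomy (Encodable.encode (p, q, r)) (Encodable.encode (p', q', r')) with h | h | h
  · exact Or.inr (Or.inl (h4 _ _ h))
  · have := Encodable.encode_injective h
    simp only [Prod.mk.injEq] at this
    exact Or.inl this
  · exact Or.inr (Or.inr (h4 _ _ h))

theorem window_unique {p p' : ι} {q r q' r' j j' : ℕ} (hj : j ≤ len p q r)
    (hj' : j' ≤ len p' q' r') (h : 4 * len p q r - j = 4 * len p' q' r' - j') :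
    p = p' ∧ q = q' ∧ r = r' ∧ j = j' := by
  have h1 := len_pos p q r
  have h2 := len_pos p' q' r'
  rcases len_trichotomy p p' q r q' r' with ⟨rfl, rfl, rfl⟩ | h3 | h3
  · exact ⟨rfl, rfl, rfl, by omega⟩
  · omega
  · omega

/-- The intervals `(l, 4l]` are disjoint, so at any one time a tail coordinate receives a new
coefficient from at most one window. -/
theorem gap_unique {p p' : ι} {q r q' r' t : ℕ} (h : len p q r < t ∧ t ≤ 4 * len p q r)
    (h' : len p' q' r' < t ∧ t ≤ 4 * len p' q' r') : p = p' ∧ q = q' ∧ r = r' := by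
  rcases len_trichotomy p p' q r q' r' with h3 | h3 | h3
  · exact h3
  · omega
  · omega

/-- The sum of the values of `x` at the position `j`, counted from the right, of the windows that
are labelled by `p` and `q`. -/
def windowSum (x : Ambient ι) (p : ι) (q j : ℕ) : ℂ :=
  ∑ r ∈ Finset.range (4 ^ q), if j ≤ len p q r then x (coeff (4 * len p q r - j)) else 0

/-- The tail coordinates are the window sums, corrected by the branch coordinates. -/
def space (ι : Type) [Encodable ι] : Submodule ℂ (Ambient ι) where
  carrier := {x | ∀ p q j, x (tail p q j) = windowSum x p q j - if j = 0 then x (branch p) else 0}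
  zero_mem' := fun p q j => by simp [windowSum]
  add_mem' := by
    intro x y hx hy p q j
    have h : windowSum (x + y) p q j = windowSum x p q j + windowSum y p q j := by
      unfold windowSum
      rw [← Finset.sum_add_distrib]
      refine Finset.sum_congr rfl fun r _ => ?_
      split_ifs <;> simp
    rw [h, lp.coeFn_add, Pi.add_apply, Pi.add_apply, hx, hy]
    split_ifs <;> ring
  smul_mem' := by
    intro c x hx p q j
    have h : windowSum (c • x) p q j = c * windowSum x p q j := by
      unfold windowSum
      rw [Finset.mul_sum]
      refine Finset.sum_congr rfl fun r _ => ?_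
      split_ifs <;> simp
    rw [h, lp.coeFn_smul, Pi.smul_apply, Pi.smul_apply, hx, smul_eq_mul, smul_eq_mul]
    split_ifs <;> ring

theorem mem_space {x : Ambient ι} : x ∈ space ι ↔
    ∀ p q j, x (tail p q j) = windowSum x p q j - if j = 0 then x (branch p) else 0 := Iff.rfl

theorem isClosed_space : IsClosed (space ι : Set (Ambient ι)) := by
  have h : (space ι : Set (Ambient ι)) = ⋂ (p : ι) (q : ℕ) (j : ℕ),
      {x | x (tail p q j) = windowSum x p q j - if j = 0 then x (branch p) else 0} := by
    ext x
    simp [mem_space]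
  rw [h]
  refine isClosed_iInter fun p => isClosed_iInter fun q => isClosed_iInter fun j => ?_
  refine isClosed_eq (continuous_apply _) (Continuous.sub ?_ ?_)
  · refine continuous_finsetSum _ fun r _ => ?_
    split_ifs
    · exact continuous_apply _
    · exact continuous_const
  · split_ifs
    · exact continuous_apply _
    · exact continuous_const

instance : Inner ℂ (space ι) := InnerProductSpace.toInner

instance : CompleteSpace (space ι) := isClosed_space.completeSpace_coe

instance : TopologicalSpace.SeparableSpace (space ι) := by
  have := separableSpace_lp (J := Coord ι)
  have : SecondCountableTopology (Ambient ι) := UniformSpace.secondCountable_of_separable _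
  infer_instance

/-- If the coefficients vanish, then `x (tail p q 0) = -x (branch p)` for all `q`, and a constant
sequence is square summable only if it is zero. So elements of the space are determined by their
power series. -/
theorem eq_zero_of_coeff_eq_zero {x : Ambient ι} (hx : x ∈ space ι)
    (h : ∀ i, x (coeff i) = 0) : x = 0 := by
  have hw : ∀ p q j, windowSum x p q j = 0 := fun p q j => by simp [windowSum, h]
  have hb : ∀ p, x (branch p) = 0 := fun p => by
    have h1 : Summable fun i => ‖x i‖ ^ (2 : ENNReal).toReal :=
      (lp.memℓp x).summable (by norm_num)
    have h2 : Summable fun q : ℕ => ‖x (tail p q 0)‖ ^ (2 : ENNReal).toReal :=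
      h1.comp_injective (i := fun q : ℕ => tail p q 0) fun a b h => by simpa using h
    simp only [hx p, hw, if_true, zero_sub, norm_neg] at h2
    have h3 := (summable_const_iff _).1 h2
    simpa using h3
  ext (p | i | ⟨p, q, j⟩)
  · exact hb p
  · exact h i
  · rw [hx p q j, hw, hb]; simp

theorem ext_coeff {x y : space ι} (h : ∀ i, (x : Ambient ι) (coeff i) = (y : Ambient ι) (coeff i)) :
    x = y := by
  rw [← sub_eq_zero]
  refine Subtype.ext (eq_zero_of_coeff_eq_zero (x - y).2 fun i => ?_)
  simp [h]

/-! ### The operator and its powers. -/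

open Classical in
/-- The part of the powers of the operator that creates tails from coefficients. -/
def createFun (n : ℕ) : Coord ι → Option (Coord ι)
  | branch _ => none
  | coeff _ => none
  | tail p q j =>
    if h : ∃ r < 4 ^ q, j ≤ len p q r ∧ len p q r < j + n ∧ j + n ≤ 4 * len p q r then
      some (coeff (4 * len p q h.choose - (j + n))) else none

theorem createFun_eq_some {n : ℕ} {c i : Coord ι} (h : createFun n c = some i) :
    ∃ p q j r, c = tail p q j ∧ j ≤ len p q r ∧ j + n ≤ 4 * len p q r ∧
      i = coeff (4 * len p q r - (j + n)) := by
  rcases c with p | i | ⟨p, q, j⟩ <;> simp only [createFun, reduceCtorEq] at h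
  split_ifs at h with h1
  have h2 := h1.choose_spec
  exact ⟨p, q, j, h1.choose, rfl, h2.2.1, h2.2.2.2, (Option.some.inj h).symm⟩

/-- Adding `n` to the index of the created coefficient gives `4 * len p q r - j`, a window position,
which determines `p`, `q` and `j`. -/
theorem createFun_injective (n : ℕ) (j₁ j₂ i : Coord ι) (h₁ : createFun n j₁ = some i)
    (h₂ : createFun n j₂ = some i) : j₁ = j₂ := by
  obtain ⟨p, q, j, r, rfl, h1, h2, rfl⟩ := createFun_eq_some h₁
  obtain ⟨p', q', j', r', rfl, h1', h2', h⟩ := createFun_eq_some h₂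
  rw [coeff.injEq] at h
  obtain ⟨rfl, rfl, -, rfl⟩ := window_unique h1 h1' (by omega)
  rfl

/-- The `n`-th power of the operator, on the ambient space. -/
def powAmbient (n : ℕ) : Ambient ι →L[ℂ] Ambient ι :=
  lpPartialComp (moveFun n) (moveFun_injective n) +
    lpPartialComp (createFun n) (createFun_injective n)

theorem powAmbient_branch (n : ℕ) (x : Ambient ι) (p : ι) : powAmbient n x (branch p) = 0 := by
  change (0 : ℂ) + 0 = 0
  simp

theorem powAmbient_coeff (n : ℕ) (x : Ambient ι) (i : ℕ) :
    powAmbient n x (coeff i) = if n ≤ i then x (coeff (i - n)) else 0 := by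
  change (moveFun n (coeff i)).elim 0 (fun i => x i) + 0 = _
  simp only [moveFun, add_zero]
  split_ifs <;> rfl

theorem powAmbient_tail (n : ℕ) (x : Ambient ι) (p : ι) (q j : ℕ) :
    powAmbient n x (tail p q j) = x (tail p q (j + n)) + ∑ r ∈ Finset.range (4 ^ q),
      if j ≤ len p q r ∧ len p q r < j + n ∧ j + n ≤ 4 * len p q r then
        x (coeff (4 * len p q r - (j + n))) else 0 := by
  change x (tail p q (j + n)) + (createFun n (tail p q j)).elim 0 (fun i => x i) = _
  congr 1
  simp only [createFun]
  split_ifs with h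
  · have h1 := h.choose_spec
    rw [Finset.sum_eq_single_of_mem h.choose (Finset.mem_range.2 h1.1), if_pos h1.2]
    · rfl
    · intro r _ hr
      refine if_neg fun h2 => hr ?_
      exact (gap_unique h2.2 h1.2.2).2.2
  · symm
    exact Finset.sum_eq_zero fun r hr =>
      if_neg fun h2 => h ⟨r, Finset.mem_range.1 hr, h2⟩

/-- A term of the shifted window sum comes from inside the same window when `j + n ≤ len p q r`, and
belongs to the old tail at `j + n`; otherwise it is a created term. As `j + n ≥ 1`, the old tail has
no branch correction, so the new branch coordinate has to be `0`. -/
theorem powAmbient_mem {n : ℕ} (hn : 1 ≤ n) {x : Ambient ι} (hx : x ∈ space ι) :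
    powAmbient n x ∈ space ι := by
  intro p q j
  rw [powAmbient_tail, powAmbient_branch, hx, if_neg (by omega), ite_self, sub_zero, sub_zero]
  unfold windowSum
  rw [← Finset.sum_add_distrib]
  refine Finset.sum_congr rfl fun r _ => ?_
  have h1 := len_pos p q r
  rw [powAmbient_coeff]
  by_cases h2 : j + n ≤ len p q r
  · rw [if_pos h2, if_neg (by omega), if_pos (by omega), if_pos (by omega), add_zero, Nat.sub_sub]
  · rw [if_neg h2, zero_add]
    by_cases h3 : j ≤ len p q r
    · by_cases h4 : j + n ≤ 4 * len p q r
      · rw [if_pos ⟨h3, by omega, h4⟩, if_pos h3, if_pos (by omega), Nat.sub_sub]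
      · rw [if_neg (by omega), if_pos h3, if_neg (by omega)]
    · rw [if_neg (by omega), if_neg h3]

/-- The `(n + 1)`-st power of the operator. -/
def powSucc (n : ℕ) : space ι →L[ℂ] space ι :=
  (powAmbient (n + 1) ∘L (space ι).subtypeL).codRestrict (space ι)
    fun x => powAmbient_mem (by omega) x.2

theorem coe_powSucc (n : ℕ) (x : space ι) : (powSucc n x : Ambient ι) = powAmbient (n + 1) x := rfl

/-- The operator. -/
def op : space ι →L[ℂ] space ι := powSucc 0

theorem op_pow_succ (n : ℕ) : (op : space ι →L[ℂ] space ι) ^ (n + 1) = powSucc n := by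
  induction n with
  | zero => exact pow_one _
  | succ n ih =>
    rw [pow_succ', ih]
    refine ContinuousLinearMap.ext fun x => ext_coeff fun i => ?_
    rw [mul_apply_eq_comp, op, coe_powSucc, coe_powSucc, coe_powSucc, powAmbient_coeff,
      powAmbient_coeff, powAmbient_coeff]
    split_ifs
    · rw [show i - (0 + 1) - (n + 1) = i - (n + 1 + 1) by omega]
    all_goals first | rfl | omega

theorem norm_powSucc_le (n : ℕ) : ‖(powSucc n : space ι →L[ℂ] space ι)‖ ≤ 2 := by
  refine ContinuousLinearMap.opNorm_le_bound _ zero_le_two fun x => ?_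
  change ‖powAmbient (n + 1) (x : Ambient ι)‖ ≤ 2 * ‖(x : Ambient ι)‖
  rw [two_mul]
  exact (norm_add_le _ _).trans (add_le_add (norm_lpPartialComp_apply_le _)
    (norm_lpPartialComp_apply_le _))

theorem isPowerBounded_op : IsPowerBounded (op : space ι →L[ℂ] space ι) := by
  refine ⟨2, fun n hn => ?_⟩
  obtain ⟨n, rfl⟩ := Nat.exists_eq_add_of_le' hn
  rw [op_pow_succ]
  exact norm_powSucc_le n

/-! ### The quasiaffinity to the Hardy space. -/

/-- The map to the Hardy space that is given by the Taylor coefficients. -/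
def toHardy : space ι →L[ℂ] HardyH2 :=
  HardyH2.coeffIsometry.symm.toContinuousLinearEquiv.toContinuousLinearMap ∘L
    coeffs ∘L (space ι).subtypeL

theorem coeffEquiv_toHardy (x : space ι) : HardyH2.coeffEquiv (toHardy x) = coeffs (x : Ambient ι) :=
  HardyH2.coeffEquiv.apply_symm_apply _

theorem coeffEquiv_toHardy_apply (x : space ι) (i : ℕ) :
    HardyH2.coeffEquiv (toHardy x) i = (x : Ambient ι) (coeff i) := by
  rw [coeffEquiv_toHardy, coeffs_apply]

theorem toHardy_injective : Function.Injective (toHardy : space ι →L[ℂ] HardyH2) := fun x y h =>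
  ext_coeff fun i => by rw [← coeffEquiv_toHardy_apply, h, coeffEquiv_toHardy_apply]

theorem toHardy_comp_op : toHardy ∘L (op : space ι →L[ℂ] space ι) = HardyH2.shift ∘L toHardy := by
  refine ContinuousLinearMap.ext fun x => HardyH2.coeffEquiv.injective ?_
  change HardyH2.coeffEquiv (toHardy (op x)) = HardyH2.coeffEquiv (HardyH2.shift (toHardy x))
  rw [HardyH2.coeffEquiv_eq (f := HardyH2.shift (toHardy x)) (HardyH2.hasSum_shiftSeq _)]
  ext i
  rw [coeffEquiv_toHardy_apply, op, coe_powSucc, powAmbient_coeff]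
  cases i with
  | zero => rfl
  | succ i =>
    rw [if_pos (by omega)]
    exact (coeffEquiv_toHardy_apply x i).symm

theorem norm_toHardy_apply_le (x : space ι) : ‖toHardy x‖ ≤ ‖x‖ := by
  rw [HardyH2.norm_eq, coeffEquiv_toHardy]
  exact norm_lpPartialComp_apply_le _

theorem single_coeff_mem {i : ℕ}
    (hi : ∀ (p : ι) (q r j : ℕ), r < 4 ^ q → j ≤ len p q r → 4 * len p q r - j ≠ i) :
    (lp.single 2 (coeff i) 1 : Ambient ι) ∈ space ι := by
  intro p q j
  have h : windowSum (lp.single 2 (coeff i) 1 : Ambient ι) p q j = 0 := by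
    refine Finset.sum_eq_zero fun r hr => ?_
    split_ifs with h
    · exact lp.single_apply_ne 2 _ _ fun h' =>
        hi p q r j (Finset.mem_range.1 hr) h (coeff.inj h')
    · rfl
  rw [h, lp.single_apply_ne 2 _ _ (by simp), lp.single_apply_ne 2 _ _ (by simp), ite_self, sub_zero]

/-- A monomial at a window position affects a single window sum, so one tail coordinate compensates
for it. -/
theorem single_coeff_add_single_tail_mem {p : ι} {q r j : ℕ} (hr : r < 4 ^ q)
    (hj : j ≤ len p q r) :
    (lp.single 2 (coeff (4 * len p q r - j)) 1 + lp.single 2 (tail p q j) 1 : Ambient ι) ∈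
      space ι := by
  intro p' q' j'
  have h : windowSum (lp.single 2 (coeff (4 * len p q r - j)) 1 + lp.single 2 (tail p q j) 1 :
      Ambient ι) p' q' j' = (lp.single 2 (tail p q j) 1 : Ambient ι) (tail p' q' j') := by
    have h1 : ∀ i, (lp.single 2 (coeff (4 * len p q r - j)) 1 + lp.single 2 (tail p q j) 1 :
        Ambient ι) (coeff i) = if i = 4 * len p q r - j then 1 else 0 := fun i => by
      rw [lp.coeFn_add, Pi.add_apply, lp.single_apply_ne 2 (tail p q j) _ (by simp), add_zero,
        lp.single_apply, Pi.single_apply]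
      simp
    unfold windowSum
    simp only [h1]
    by_cases h2 : tail p' q' j' = tail p q j
    · obtain ⟨rfl, rfl, rfl⟩ := tail.inj h2
      rw [lp.single_apply_self, Finset.sum_eq_single_of_mem r (Finset.mem_range.2 hr)]
      · simp [hj]
      · intro r' _ hr'
        split_ifs with h3 h4
        · exact absurd (window_unique h3 hj h4).2.2.1 hr'
        · rfl
        · rfl
    · rw [lp.single_apply_ne 2 _ _ h2]
      refine Finset.sum_eq_zero fun r' _ => ?_
      split_ifs with h3 h4
      · obtain ⟨rfl, rfl, -, rfl⟩ := window_unique h3 hj h4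
        exact absurd rfl h2
      · rfl
      · rfl
  rw [h]
  simp only [lp.coeFn_add, Pi.add_apply]
  rw [lp.single_apply_ne 2 (coeff _) _ (by simp), lp.single_apply_ne 2 (coeff _) _ (by simp),
    lp.single_apply_ne 2 (tail p q j) (j := branch p') _ (by simp)]
  simp

theorem exists_coeff_eq_ite (ι : Type) [Encodable ι] (i : ℕ) :
    ∃ w : space ι, ∀ k, (w : Ambient ι) (coeff k) = if k = i then 1 else 0 := by
  by_cases hi : ∀ (p : ι) (q r j : ℕ), r < 4 ^ q → j ≤ len p q r → 4 * len p q r - j ≠ i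
  · refine ⟨⟨_, single_coeff_mem hi⟩, fun k => ?_⟩
    rw [lp.single_apply, Pi.single_apply]
    simp
  · push Not at hi
    obtain ⟨p, q, r, j, hr, hj, rfl⟩ := hi
    refine ⟨⟨_, single_coeff_add_single_tail_mem hr hj⟩, fun k => ?_⟩
    rw [lp.coeFn_add, Pi.add_apply, lp.single_apply_ne 2 (tail p q j) _ (by simp), add_zero,
      lp.single_apply, Pi.single_apply]
    simp

theorem denseRange_toHardy : DenseRange (toHardy : space ι →L[ℂ] HardyH2) := by
  have h : (LinearMap.range (toHardy : space ι →L[ℂ] HardyH2).toLinearMap)ᗮ = ⊥ := by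
    rw [Submodule.eq_bot_iff]
    intro f hf
    refine HardyH2.coeffEquiv.injective ?_
    rw [map_zero]
    ext i
    obtain ⟨w, hw⟩ := exists_coeff_eq_ite ι i
    have h1 : inner ℂ (toHardy w) f = 0 := (Submodule.mem_orthogonal _ _).1 hf _ ⟨w, rfl⟩
    rw [HardyH2.inner_eq_tsum, tsum_eq_single i fun k hk => by
      rw [coeffEquiv_toHardy_apply, hw, if_neg hk, inner_zero_left], coeffEquiv_toHardy_apply, hw,
      if_pos rfl] at h1
    simpa using h1
  rw [← Submodule.topologicalClosure_eq_top_iff, ← Submodule.dense_iff_topologicalClosure_eq_top]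
    at h
  exact h

/-! ### The kernel of the adjoint. -/

theorem mem_ker_adjoint_op {u : space ι} :
    u ∈ (ContinuousLinearMap.adjoint (op : space ι →L[ℂ] space ι)).ker ↔
      ∀ x, inner ℂ u (op x) = 0 := by
  rw [LinearMap.mem_ker]
  constructor
  · intro h x
    rw [← ContinuousLinearMap.adjoint_inner_left]
    erw [h]
    exact inner_zero_left _
  · intro h
    refine ext_inner_right ℂ fun x => ?_
    erw [ContinuousLinearMap.adjoint_inner_left]
    rw [h, inner_zero_left]

/-- The monomial of degree `i + 1` is the image under the operator of the one of degree `i`. -/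
theorem inner_eq_zero_of_mem_ker {u w : space ι}
    (hu : u ∈ (ContinuousLinearMap.adjoint (op : space ι →L[ℂ] space ι)).ker) {i : ℕ}
    (hw : ∀ k, (w : Ambient ι) (coeff k) = if k = i + 1 then 1 else 0) : inner ℂ w u = 0 := by
  obtain ⟨v, hv⟩ := exists_coeff_eq_ite ι i
  have h : w = op v := ext_coeff fun k => by
    rw [hw, op, coe_powSucc, powAmbient_coeff, hv, zero_add]
    split_ifs <;> first | rfl | omega
  rw [h]
  exact inner_eq_zero_symm.1 (mem_ker_adjoint_op.1 hu v)

theorem coeff_eq_zero_of_mem_ker {u : space ι}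
    (hu : u ∈ (ContinuousLinearMap.adjoint (op : space ι →L[ℂ] space ι)).ker) {i : ℕ}
    (hi : ∀ (p : ι) (q r j : ℕ), r < 4 ^ q → j ≤ len p q r → 4 * len p q r - j ≠ i + 1) :
    (u : Ambient ι) (coeff (i + 1)) = 0 := by
  rw [← inner_single_one_left]
  refine inner_eq_zero_of_mem_ker (w := ⟨_, single_coeff_mem hi⟩) hu (i := i) fun k => ?_
  rw [lp.single_apply, Pi.single_apply]
  simp

theorem coeff_eq_neg_tail_of_mem_ker {u : space ι}
    (hu : u ∈ (ContinuousLinearMap.adjoint (op : space ι →L[ℂ] space ι)).ker) {p : ι}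
    {q r j : ℕ} (hr : r < 4 ^ q) (hj : j ≤ len p q r) :
    (u : Ambient ι) (coeff (4 * len p q r - j)) = -(u : Ambient ι) (tail p q j) := by
  have h := inner_eq_zero_of_mem_ker
    (w := ⟨_, single_coeff_add_single_tail_mem hr hj⟩) hu (i := 4 * len p q r - j - 1) fun k => by
      rw [lp.coeFn_add, Pi.add_apply, lp.single_apply_ne 2 (tail p q j) _ (by simp), add_zero,
        lp.single_apply, Pi.single_apply, Nat.sub_add_cancel]
      · simp
      · have := len_pos p q r
        omega
  rw [Submodule.coe_inner, inner_add_left, inner_single_one_left, inner_single_one_left] at h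
  exact eq_neg_of_add_eq_zero_left h

/-- By the previous lemma each term of the window sum is `-u (tail p q j)`; the extra `1` is the
tail on the left of the defining equation. Hence tails with `j ≠ 0` vanish and the others are fixed
by the branch coordinates. -/
theorem tail_eq_of_mem_ker {u : space ι}
    (hu : u ∈ (ContinuousLinearMap.adjoint (op : space ι →L[ℂ] space ι)).ker) (p : ι) (q j : ℕ) :
    (((Finset.range (4 ^ q)).filter fun r => j ≤ len p q r).card + 1 : ℂ) *
      (u : Ambient ι) (tail p q j) = -if j = 0 then (u : Ambient ι) (branch p) else 0 := by
  have h := u.2 p q j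
  have h1 : windowSum (u : Ambient ι) p q j =
      -(((Finset.range (4 ^ q)).filter fun r => j ≤ len p q r).card *
        (u : Ambient ι) (tail p q j)) := by
    have h2 : ∀ r ∈ (Finset.range (4 ^ q)).filter fun r => j ≤ len p q r,
        (u : Ambient ι) (coeff (4 * len p q r - j)) = -(u : Ambient ι) (tail p q j) := fun r hr =>
      coeff_eq_neg_tail_of_mem_ker hu (Finset.mem_range.1 (Finset.mem_filter.1 hr).1)
        (Finset.mem_filter.1 hr).2
    refine (Finset.sum_filter _ _).symm.trans ((Finset.sum_congr rfl h2).trans ?_)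
    simp
  rw [h1] at h
  linear_combination h

theorem eq_zero_of_mem_ker {u : space ι}
    (hu : u ∈ (ContinuousLinearMap.adjoint (op : space ι →L[ℂ] space ι)).ker)
    (h0 : (u : Ambient ι) (coeff 0) = 0) (hb : ∀ p, (u : Ambient ι) (branch p) = 0) : u = 0 := by
  have ht : ∀ p q j, (u : Ambient ι) (tail p q j) = 0 := fun p q j => by
    have h := tail_eq_of_mem_ker hu p q j
    rw [hb, ite_self, neg_zero] at h
    exact (mul_eq_zero.1 h).resolve_left (Nat.cast_add_one_ne_zero _)
  refine Subtype.ext (eq_zero_of_coeff_eq_zero u.2 fun i => ?_)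
  cases i with
  | zero => exact h0
  | succ i =>
    by_cases hi : ∀ (p : ι) (q r j : ℕ), r < 4 ^ q → j ≤ len p q r → 4 * len p q r - j ≠ i + 1
    · exact coeff_eq_zero_of_mem_ker hu hi
    · push Not at hi
      obtain ⟨p, q, r, j, hr, hj, h⟩ := hi
      rw [← h, coeff_eq_neg_tail_of_mem_ker hu hr hj, ht, neg_zero]

theorem coeff_window_end_of_mem_ker {u : space ι}
    (hu : u ∈ (ContinuousLinearMap.adjoint (op : space ι →L[ℂ] space ι)).ker) (p : ι) {q r : ℕ}
    (hr : r < 4 ^ q) :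
    (u : Ambient ι) (coeff (4 * len p q r)) = (4 ^ q + 1 : ℂ)⁻¹ * (u : Ambient ι) (branch p) := by
  have h := tail_eq_of_mem_ker hu p q 0
  have h1 := coeff_eq_neg_tail_of_mem_ker hu hr (Nat.zero_le (len p q r))
  have h2 : (4 ^ q + 1 : ℂ) ≠ 0 := by exact_mod_cast Nat.succ_ne_zero (4 ^ q)
  rw [Nat.sub_zero] at h1
  simp only [Nat.zero_le, Finset.filter_true, Finset.card_range, if_true] at h
  push_cast at h
  rw [h1]
  field_simp
  linear_combination -h

/-- The sum of the monomials at the right ends of the windows that are labelled by `p` and `q`. -/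
def blockSum (p : ι) (q : ℕ) : Ambient ι :=
  ∑ r ∈ Finset.range (4 ^ q), lp.single 2 (coeff (4 * len p q r)) 1

theorem inner_blockSum_left (p : ι) (q : ℕ) (x : Ambient ι) :
    inner ℂ (blockSum p q) x = ∑ r ∈ Finset.range (4 ^ q), x (coeff (4 * len p q r)) := by
  unfold blockSum
  rw [sum_inner]
  exact Finset.sum_congr rfl fun r _ => inner_single_one_left _ _

theorem blockSum_apply (p : ι) (q : ℕ) (c : Coord ι) : blockSum p q c =
    ∑ r ∈ Finset.range (4 ^ q), if c = coeff (4 * len p q r) then 1 else 0 := by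
  unfold blockSum
  rw [lp.coeFn_sum, Finset.sum_apply]
  exact Finset.sum_congr rfl fun r _ => by rw [lp.single_apply, Pi.single_apply]

open Classical in
theorem blockSum_apply_coeff {p p' : ι} {q q' r j : ℕ} (hr : r < 4 ^ q') (hj : j ≤ len p' q' r) :
    blockSum p q (coeff (4 * len p' q' r - j)) = if p = p' ∧ q = q' ∧ j = 0 then 1 else 0 := by
  rw [blockSum_apply]
  split_ifs with h
  · obtain ⟨rfl, rfl, rfl⟩ := h
    rw [Finset.sum_eq_single_of_mem r (Finset.mem_range.2 hr)]
    · simp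
    · intro r' _ hr'
      refine if_neg fun h => hr' ?_
      exact (window_unique (Nat.zero_le _) (Nat.zero_le _) (coeff.inj h)).2.2.1.symm
  · refine Finset.sum_eq_zero fun r' _ => if_neg fun h' => h ?_
    obtain ⟨rfl, rfl, -, rfl⟩ := window_unique hj (Nat.zero_le (len p q r')) (coeff.inj h')
    exact ⟨rfl, rfl, rfl⟩

theorem norm_blockSum (p : ι) (q : ℕ) : ‖blockSum p q‖ = 2 ^ q := by
  have h : inner ℂ (blockSum p q) (blockSum p q) = 4 ^ q := by
    have h1 : ∀ r ∈ Finset.range (4 ^ q), blockSum p q (coeff (4 * len p q r)) = 1 := fun r hr => by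
      simpa using blockSum_apply_coeff (p := p) (p' := p) (q := q) (Finset.mem_range.1 hr)
        (Nat.zero_le (len p q r))
    rw [inner_blockSum_left]
    refine (Finset.sum_congr rfl h1).trans ?_
    simp
  rw [inner_self_eq_norm_sq_to_K] at h
  have h2 : ‖blockSum p q‖ ^ 2 = (2 ^ q) ^ 2 := by
    have h3 : ‖blockSum p q‖ ^ 2 = 4 ^ q := by
      refine Complex.ofReal_injective ?_
      push_cast
      exact h
    rw [h3, ← pow_mul, mul_comm, pow_mul]
    norm_num
  exact (pow_left_inj₀ (norm_nonneg _) (by positivity) two_ne_zero).1 h2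

theorem summable_smul_blockSum (p : ι) : Summable fun q : ℕ => (4 ^ q : ℂ)⁻¹ • blockSum p q := by
  refine Summable.of_norm ?_
  refine (summable_geometric_two).congr fun q => ?_
  rw [norm_smul, norm_blockSum, norm_inv, norm_pow, one_div, inv_pow]
  have h : ‖(4 : ℂ)‖ = 2 * 2 := by norm_num
  rw [h, mul_pow]
  field_simp

/-- An element with a single nonzero branch coordinate. -/
def branchVec (p : ι) : Ambient ι :=
  lp.single 2 (branch p) 1 + ∑' q : ℕ, (4 ^ q : ℂ)⁻¹ • blockSum p q

theorem branchVec_apply (p : ι) (c : Coord ι) : branchVec p c =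
    (if c = branch p then 1 else 0) + ∑' q : ℕ, (4 ^ q : ℂ)⁻¹ * blockSum p q c := by
  have h := ((summable_smul_blockSum p).hasSum.mapL
    (lp.evalCLM ℂ (fun _ : Coord ι => ℂ) 2 c)).tsum_eq
  unfold branchVec
  rw [lp.coeFn_add, Pi.add_apply, lp.single_apply, Pi.single_apply]
  congr 1
  exact h.symm

open Classical in
theorem branchVec_branch (p p' : ι) :
    branchVec p (branch p') = if p' = p then 1 else 0 := by
  have h : ∀ q, blockSum p q (branch p') = 0 := fun q => by simp [blockSum_apply]
  rw [branchVec_apply]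
  simp [h]

/-- At `j = 0` the `4^q` windows each carry `4^{-q}`; their sum `1` cancels the branch coordinate,
and all tails are zero. -/
theorem branchVec_mem (p : ι) : branchVec p ∈ space ι := by
  classical
  intro p' q' j
  have h : ∀ q, blockSum p q (tail p' q' j) = 0 := fun q => by simp [blockSum_apply]
  have h1 : ∀ r ∈ Finset.range (4 ^ q'), (if j ≤ len p' q' r then
      branchVec p (coeff (4 * len p' q' r - j)) else 0) =
      if p = p' ∧ j = 0 then (4 ^ q' : ℂ)⁻¹ else 0 := fun r hr => by
    by_cases hj : j ≤ len p' q' r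
    · rw [if_pos hj, branchVec_apply, if_neg (by simp), zero_add]
      simp only [blockSum_apply_coeff (Finset.mem_range.1 hr) hj]
      rw [tsum_eq_single q' fun q hq => by simp [hq]]
      simp
    · rw [if_neg hj, if_neg (by omega)]
  unfold windowSum
  rw [Finset.sum_congr rfl h1, branchVec_branch, branchVec_apply]
  simp only [h]
  have h4 : ((4 : ℂ) ^ q') ≠ 0 := pow_ne_zero _ (by norm_num)
  by_cases hp : p = p' <;> by_cases hj : j = 0 <;> simp [hp, hj, eq_comm, mul_inv_cancel₀ h4]

theorem inner_smul_blockSum_of_mem_ker {u : space ι}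
    (hu : u ∈ (ContinuousLinearMap.adjoint (op : space ι →L[ℂ] space ι)).ker) (p : ι) (q : ℕ) :
    inner ℂ (u : Ambient ι) ((4 ^ q : ℂ)⁻¹ • blockSum p q) =
      (((4 ^ q + 1 : ℝ)⁻¹ : ℝ) : ℂ) * conj ((u : Ambient ι) (branch p)) := by
  have h4 : ((4 : ℂ) ^ q) ≠ 0 := pow_ne_zero _ (by norm_num)
  have h5 : inner ℂ (blockSum p q) (u : Ambient ι) =
      4 ^ q * ((4 ^ q + 1 : ℂ)⁻¹ * (u : Ambient ι) (branch p)) := by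
    have h7 : ∀ r ∈ Finset.range (4 ^ q), (u : Ambient ι) (coeff (4 * len p q r)) =
        (4 ^ q + 1 : ℂ)⁻¹ * (u : Ambient ι) (branch p) := fun r hr =>
      coeff_window_end_of_mem_ker hu p (Finset.mem_range.1 hr)
    rw [inner_blockSum_left]
    refine (Finset.sum_congr rfl h7).trans ?_
    rw [Finset.sum_const, Finset.card_range, nsmul_eq_mul, Nat.cast_pow, Nat.cast_ofNat]
  have h6 : ∀ z : ℂ, (4 ^ q : ℂ)⁻¹ * conj (4 ^ q * ((4 ^ q + 1 : ℂ)⁻¹ * z)) =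
      (((4 ^ q + 1 : ℝ)⁻¹ : ℝ) : ℂ) * conj z := fun z => by
    simp only [map_mul, map_inv₀, map_add, map_pow, map_one, Complex.conj_ofNat]
    push_cast
    rw [inv_mul_cancel_left₀ h4]
  rw [inner_smul_right, ← inner_conj_symm, h5]
  exact h6 _

/-- The branch coordinate contributes `1` to `c`, and the block `q` contributes `(4^q + 1)⁻¹`. For
`u` in the kernel, the pairing with `branchVec p` thus detects the branch coordinate of `u`; this
yields the orthogonality of the vectors `branchDual`. -/
theorem inner_branchVec_of_mem_ker {u : space ι}
    (hu : u ∈ (ContinuousLinearMap.adjoint (op : space ι →L[ℂ] space ι)).ker) (p : ι) :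
    ∃ c : ℝ, 0 < c ∧ inner ℂ (u : Ambient ι) (branchVec p) =
      c * conj ((u : Ambient ι) (branch p)) := by
  have h1 : HasSum (fun q => inner ℂ (u : Ambient ι) ((4 ^ q : ℂ)⁻¹ • blockSum p q))
      (inner ℂ (u : Ambient ι) (∑' q : ℕ, (4 ^ q : ℂ)⁻¹ • blockSum p q)) :=
    (summable_smul_blockSum p).hasSum.mapL (innerSL ℂ (u : Ambient ι))
  have h3 : Summable fun q : ℕ => (4 ^ q + 1 : ℝ)⁻¹ := by
    refine Summable.of_nonneg_of_le (fun q => by positivity) (fun q => ?_)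
      (summable_geometric_of_lt_one (r := (1 / 4 : ℝ)) (by norm_num) (by norm_num))
    rw [one_div, inv_pow]
    exact inv_anti₀ (by positivity) (by linarith)
  have h5 := (Complex.hasSum_ofReal.2 h3.hasSum).mul_right (conj ((u : Ambient ι) (branch p)))
  have h6 := h1.unique (h5.congr_fun fun q => inner_smul_blockSum_of_mem_ker hu p q)
  refine ⟨1 + ∑' q : ℕ, (4 ^ q + 1 : ℝ)⁻¹, ?_, ?_⟩
  · have : 0 ≤ ∑' q : ℕ, (4 ^ q + 1 : ℝ)⁻¹ := tsum_nonneg fun q => by positivity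
    linarith
  · unfold branchVec
    rw [inner_add_right, ← inner_conj_symm, inner_single_one_left, h6, Complex.ofReal_add,
      Complex.ofReal_one, add_mul, one_mul]

/-- The vector that represents the branch coordinate. -/
def branchDual (p : ι) : space ι :=
  ContinuousLinearMap.adjoint (space ι).subtypeL (lp.single 2 (branch p) 1)

theorem inner_branchDual_left (p : ι) (x : space ι) :
    inner ℂ (branchDual p) x = (x : Ambient ι) (branch p) := by
  unfold branchDual
  rw [ContinuousLinearMap.adjoint_inner_left]
  exact inner_single_one_left _ _

theorem branchDual_mem_ker (p : ι) :
    branchDual p ∈ (ContinuousLinearMap.adjoint (op : space ι →L[ℂ] space ι)).ker :=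
  mem_ker_adjoint_op.2 fun x => by
    rw [inner_branchDual_left, op, coe_powSucc, powAmbient_branch]

theorem branchDual_branch_eq_zero {p p' : ι} (h : p ≠ p') :
    (branchDual p' : Ambient ι) (branch p) = 0 := by
  obtain ⟨c, hc, h1⟩ := inner_branchVec_of_mem_ker (branchDual_mem_ker p') p
  have h2 := inner_branchDual_left p' ⟨_, branchVec_mem p⟩
  rw [Submodule.coe_inner, h1, branchVec_branch, if_neg h.symm] at h2
  have h3 := (mul_eq_zero.1 h2).resolve_left (by exact_mod_cast hc.ne')
  simpa using h3

theorem branchDual_ne_zero (p : ι) : branchDual p ≠ 0 := fun h => by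
  have h2 := inner_branchDual_left p ⟨_, branchVec_mem p⟩
  rw [h, inner_zero_left, branchVec_branch, if_pos rfl] at h2
  exact zero_ne_one h2

/-- The constant function `1`. -/
def constVec (ι : Type) [Encodable ι] : space ι :=
  ⟨lp.single 2 (coeff 0) 1, single_coeff_mem fun p q r j _ hj => by
    have := len_pos p q r
    omega⟩

theorem inner_constVec_left (x : space ι) :
    inner ℂ (constVec ι) x = (x : Ambient ι) (coeff 0) :=
  inner_single_one_left _ _

theorem constVec_mem_ker :
    constVec ι ∈ (ContinuousLinearMap.adjoint (op : space ι →L[ℂ] space ι)).ker :=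
  mem_ker_adjoint_op.2 fun x => by
    rw [inner_constVec_left, op, coe_powSucc, powAmbient_coeff]
    rfl

theorem constVec_branch (p : ι) : (constVec ι : Ambient ι) (branch p) = 0 :=
  lp.single_apply_ne 2 _ _ (by simp)

theorem constVec_ne_zero : constVec ι ≠ 0 := fun h => by
  have h1 : (constVec ι : Ambient ι) (coeff 0) = 1 := lp.single_apply_self 2 _ _
  rw [h] at h1
  exact zero_ne_one h1

/-- The constant function and the vectors `branchDual p` are orthogonal, and they are complete
because a kernel element is determined by its coefficient at `0` and its branch coordinates. -/
theorem hasHilbertDim_ker_adjoint_op :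
    HasHilbertDim (ContinuousLinearMap.adjoint (op : space ι →L[ℂ] space ι)).ker
      (Cardinal.mk (Option ι)) := by
  refine hasHilbertDim_of_orthogonal (fun k => k.elim ⟨_, constVec_mem_ker⟩
    fun p => ⟨_, branchDual_mem_ker p⟩) ?_ ?_ ?_
  · rintro (_ | p) h
    · exact constVec_ne_zero (congrArg Subtype.val h)
    · exact branchDual_ne_zero p (congrArg Subtype.val h)
  · rintro (_ | p) (_ | p') h
    · exact absurd rfl h
    · change inner ℂ (constVec ι) (branchDual p') = 0
      rw [← inner_conj_symm, inner_branchDual_left, constVec_branch, map_zero]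
    · exact (inner_branchDual_left p (constVec ι)).trans (constVec_branch p)
    · exact (inner_branchDual_left p (branchDual p')).trans
        (branchDual_branch_eq_zero fun hp => h (congrArg some hp))
  · intro u hu
    refine Subtype.ext (eq_zero_of_mem_ker u.2 ?_ fun p => ?_)
    · rw [← inner_constVec_left]
      exact hu none
    · rw [← inner_branchDual_left]
      exact hu (some p)

/-! ### Free indices and the estimate on the kernels `h_λ`. -/

/-- The index `i` lies in no window. -/
def IsFree (ι : Type) [Encodable ι] (i : ℕ) : Prop :=
  ∀ (p : ι) (q r j : ℕ), j ≤ len p q r → 4 * len p q r - j ≠ i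

open Classical in
/-- The elements whose coefficients vanish in the windows. -/
def freePart (ι : Type) [Encodable ι] : SeqL2 →L[ℂ] SeqL2 :=
  lpPartialComp (fun i => if IsFree ι i then some i else none) fun j₁ j₂ i h₁ h₂ => by
    simp only [Option.ite_none_right_eq_some, Option.some.injEq] at h₁ h₂
    exact h₁.2.trans h₂.2.symm

open Classical in
/-- The indices in windows are moved to free indices in front of the windows. -/
def windowShift (ι : Type) [Encodable ι] (i : ℕ) : Option ℕ :=
  if h : ∃ l : ℕ, (∃ (p : ι) (q r : ℕ), len p q r = l) ∧ ∃ j ≤ l, 4 * l - j = i then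
    some (i - (h.choose + 1)) else none

theorem windowShift_eq_some {i k : ℕ} (h : windowShift ι i = some k) :
    ∃ (p : ι) (q r j : ℕ), j ≤ len p q r ∧ i = 4 * len p q r - j ∧ k = i - (len p q r + 1) := by
  unfold windowShift at h
  split_ifs at h with h1
  obtain ⟨⟨p, q, r, hl⟩, j, hj, hi⟩ := h1.choose_spec
  refine ⟨p, q, r, j, hl ▸ hj, by rw [hl, hi], ?_⟩
  rw [hl]
  exact (Option.some.inj h).symm

theorem exists_windowShift_eq_some {i : ℕ} (h : ¬IsFree ι i) : ∃ k, windowShift ι i = some k := by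
  unfold IsFree at h
  push Not at h
  obtain ⟨p, q, r, j, hj, hi⟩ := h
  unfold windowShift
  rw [dif_pos ⟨_, ⟨p, q, r, rfl⟩, j, hj, hi⟩]
  exact ⟨_, rfl⟩

/-- Subtracting `l + 1` takes `[3l, 4l]` to `[2l - 1, 3l - 1]`, just below the window, while all
shorter windows end at or before `l` and all longer ones start beyond `4l`. -/
theorem isFree_of_windowShift {i k : ℕ} (h : windowShift ι i = some k) : IsFree ι k := by
  obtain ⟨p, q, r, j, hj, rfl, rfl⟩ := windowShift_eq_some h
  intro p' q' r' j' hj'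
  have h1 := len_pos p q r
  have h2 := len_pos p' q' r'
  rcases len_trichotomy p p' q r q' r' with ⟨rfl, rfl, rfl⟩ | h3 | h3 <;> omega

theorem windowShift_injective (i₁ i₂ k : ℕ) (h₁ : windowShift ι i₁ = some k)
    (h₂ : windowShift ι i₂ = some k) : i₁ = i₂ := by
  obtain ⟨p, q, r, j, hj, rfl, rfl⟩ := windowShift_eq_some h₁
  obtain ⟨p', q', r', j', hj', rfl, h⟩ := windowShift_eq_some h₂
  have h1 := len_pos p q r
  have h2 := len_pos p' q' r'
  rcases len_trichotomy p p' q r q' r' with ⟨rfl, rfl, rfl⟩ | h3 | h3 <;> omega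

theorem freePart_apply_of_isFree {i : ℕ} (h : IsFree ι i) (a : SeqL2) :
    freePart ι a i = a i := by
  rw [freePart, lpPartialComp_apply, if_pos h]
  rfl

theorem freePart_apply_of_not_isFree {i : ℕ} (h : ¬IsFree ι i) (a : SeqL2) :
    freePart ι a i = 0 := by
  rw [freePart, lpPartialComp_apply, if_neg h]
  rfl

/-- Each coefficient in a window is dominated by the one at a smaller free index, injectively, so
the window part has norm at most that of the free part. -/
theorem norm_le_two_mul_norm_freePart {a : SeqL2} (ha : ∀ i k, k ≤ i → ‖a i‖ ≤ ‖a k‖) :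
    ‖a‖ ≤ 2 * ‖freePart ι a‖ := by
  have h : ‖a - freePart ι a‖ ≤
      ‖lpPartialComp (windowShift ι) windowShift_injective (freePart ι a)‖ := by
    refine lp.norm_mono two_ne_zero fun i => ?_
    rw [lp.coeFn_sub, Pi.sub_apply]
    by_cases hi : IsFree ι i
    · rw [freePart_apply_of_isFree hi, sub_self, norm_zero]
      exact norm_nonneg _
    · obtain ⟨k, hk⟩ := exists_windowShift_eq_some hi
      rw [freePart_apply_of_not_isFree hi, sub_zero, lpPartialComp_apply, hk]
      change ‖a i‖ ≤ ‖freePart ι a k‖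
      rw [freePart_apply_of_isFree (isFree_of_windowShift hk)]
      obtain ⟨p, q, r, j, -, -, rfl⟩ := windowShift_eq_some hk
      exact ha _ _ (Nat.sub_le _ _)
  have h1 := h.trans (norm_lpPartialComp_apply_le _)
  have h2 := norm_le_norm_add_norm_sub' a (freePart ι a)
  linarith

theorem ofCoeffs_freePart_mem (a : SeqL2) : ofCoeffs ι (freePart ι a) ∈ space ι := by
  intro p q j
  have h : windowSum (ofCoeffs ι (freePart ι a)) p q j = 0 := by
    refine Finset.sum_eq_zero fun r _ => ?_
    split_ifs with h
    · exact freePart_apply_of_not_isFree (fun hf => hf p q r j h rfl) a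
    · rfl
  rw [h]
  change (0 : ℂ) = 0 - if j = 0 then 0 else 0
  simp

/-- The free part `g` lifts to a vector `y` of the space with no tails or branches, so `‖y‖ ≤ ‖g‖`.
Pairing gives `‖g‖² = |⟨y, X* f⟩| ≤ ‖g‖ ‖X* f‖`. -/
theorem norm_freePart_le_norm_adjoint (f : HardyH2) :
    ‖freePart ι (HardyH2.coeffEquiv f)‖ ≤
      ‖ContinuousLinearMap.adjoint (toHardy : space ι →L[ℂ] HardyH2) f‖ := by
  set g := freePart ι (HardyH2.coeffEquiv f) with hg
  let y : space ι := ⟨_, ofCoeffs_freePart_mem (HardyH2.coeffEquiv f)⟩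
  have hy : ‖y‖ ≤ ‖g‖ := norm_lpPartialComp_apply_le (hσ := coeffIndex_injective) g
  have h1 : inner ℂ y (ContinuousLinearMap.adjoint toHardy f) = inner ℂ g g := by
    rw [ContinuousLinearMap.adjoint_inner_right, HardyH2.inner_eq_tsum, lp.inner_eq_tsum]
    refine tsum_congr fun i => ?_
    rw [coeffEquiv_toHardy_apply]
    change inner ℂ (g i) _ = _
    by_cases hi : IsFree ι i
    · rw [hg, freePart_apply_of_isFree hi]
    · rw [hg, freePart_apply_of_not_isFree hi, inner_zero_left, inner_zero_left]
  have h2 := norm_inner_le_norm (𝕜 := ℂ) y (ContinuousLinearMap.adjoint toHardy f)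
  rw [h1, inner_self_eq_norm_sq_to_K, norm_pow, RCLike.norm_ofReal, abs_norm] at h2
  by_contra! h3
  have h4 : 0 < ‖g‖ := (norm_nonneg _).trans_lt h3
  nlinarith [norm_nonneg (ContinuousLinearMap.adjoint (toHardy : space ι →L[ℂ] HardyH2) f)]

theorem norm_kernel_le (l : 𝔻) : ‖HardyH2.kernel l‖ ≤
    2 * ‖ContinuousLinearMap.adjoint (toHardy : space ι →L[ℂ] HardyH2) (HardyH2.kernel l)‖ := by
  have h : ‖HardyH2.coeffEquiv (HardyH2.kernel l)‖ ≤
      2 * ‖freePart ι (HardyH2.coeffEquiv (HardyH2.kernel l))‖ :=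
    norm_le_two_mul_norm_freePart fun i k hik => by
      rw [HardyH2.coeffEquiv_kernel, HardyH2.coeffEquiv_kernel, norm_pow, norm_pow,
        RCLike.norm_conj]
      exact pow_le_pow_of_le_one (norm_nonneg _) l.norm_lt_one.le hik
  rw [HardyH2.norm_eq]
  linarith [norm_freePart_le_norm_adjoint (ι := ι) (HardyH2.kernel l)]

theorem norm_adjoint_toHardy_apply_le (f : HardyH2) :
    ‖ContinuousLinearMap.adjoint (toHardy : space ι →L[ℂ] HardyH2) f‖ ≤ ‖f‖ := by
  have h : ‖ContinuousLinearMap.adjoint (toHardy : space ι →L[ℂ] HardyH2)‖ ≤ 1 := by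
    rw [LinearIsometryEquiv.norm_map]
    exact ContinuousLinearMap.opNorm_le_bound _ zero_le_one fun x => by
      rw [one_mul]; exact norm_toHardy_apply_le x
  simpa using ContinuousLinearMap.le_of_opNorm_le _ h f

end BranchedShift

/-- The constant function supplies one dimension, so `N - 1` branches are needed for finite `N`. -/
theorem exists_encodable_mk_option_eq {N : Cardinal.{0}} (h1 : 1 ≤ N) (h2 : N ≤ Cardinal.aleph0) :
    ∃ (ι : Type) (_ : Encodable ι), Cardinal.mk (Option ι) = N := by
  rcases h2.lt_or_eq with h | rfl
  · obtain ⟨n, rfl⟩ := Cardinal.lt_aleph0.1 h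
    obtain ⟨m, rfl⟩ := Nat.exists_eq_add_of_le' (by exact_mod_cast h1 : 1 ≤ n)
    exact ⟨Fin m, inferInstance, by simp⟩
  · exact ⟨ℕ, inferInstance, by simp⟩

end

theorem mainTheorem2 :
    (∀ l : 𝔻, ‖HardyH2.kernel l‖ = 1 / (1 - ‖(l : ℂ)‖ ^ 2) ^ (1 / 2 : ℝ)) ∧
    (∀ N : Cardinal.{0}, 1 ≤ N → N ≤ Cardinal.aleph0 →
      ∃ (H : Type) (_ : NormedAddCommGroup H) (_ : InnerProductSpace ℂ H) (_ : CompleteSpace H)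
        (_ : TopologicalSpace.SeparableSpace H)
        (T : H →L[ℂ] H) (X : H →L[ℂ] HardyH2),
        IsPowerBounded T ∧ IsQuasiaffinity X ∧ X ∘L T = HardyH2.shift ∘L X ∧
        HasHilbertDim (ContinuousLinearMap.adjoint T).ker N ∧
        ∃ c C : ℝ, 0 < c ∧ 0 < C ∧ ∀ l : 𝔻,
          c * ‖HardyH2.kernel l‖ ≤ ‖ContinuousLinearMap.adjoint X (HardyH2.kernel l)‖ ∧
          ‖ContinuousLinearMap.adjoint X (HardyH2.kernel l)‖ ≤ C * ‖HardyH2.kernel l‖) ∧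
    (∀ (H : Type*) [NormedAddCommGroup H] [InnerProductSpace ℂ H] [CompleteSpace H]
      [TopologicalSpace.SeparableSpace H] (T : H →L[ℂ] H) (X : H →L[ℂ] HardyH2),
      IsPolynomiallyBounded T → IsQuasiaffinity X → X ∘L T = HardyH2.shift ∘L X →
        HasHilbertDim (ContinuousLinearMap.adjoint T).ker 1) := by
  refine ⟨HardyH2.norm_kernel, fun N h1 h2 => ?_, fun H _ _ _ _ T X hT hX hXT =>
    hT.hasHilbertDim_ker_adjoint hX hXT⟩
  obtain ⟨ι, _, rfl⟩ := exists_encodable_mk_option_eq h1 h2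
  refine ⟨BranchedShift.space ι, inferInstance, inferInstance, inferInstance, inferInstance,
    BranchedShift.op, BranchedShift.toHardy, BranchedShift.isPowerBounded_op,
    ⟨BranchedShift.toHardy_injective, BranchedShift.denseRange_toHardy⟩,
    BranchedShift.toHardy_comp_op, BranchedShift.hasHilbertDim_ker_adjoint_op, 1 / 2, 1,
    by norm_num, one_pos, fun l => ⟨?_, ?_⟩⟩
  · linarith [BranchedShift.norm_kernel_le (ι := ι) l]
  · rw [one_mul]
    exact BranchedShift.norm_adjoint_toHardy_apply_le _
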